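/- All vector spaces are over $\mathbb{C}$, and for a vector space $U$ write $U((x))$ for the formal Laurent series in $x$ with coefficients in $U$ and finitely many negative powers, and $U((x_1,x_2))=U[[x_1,x_2]][x_1^{-1},x_2^{-1}]$. Expressions $(x-y)^n$, $n\in\mathbb{Z}$, are expanded in nonnegative powers of $y$, and $\delta(x)=\sum_{n\in\mathbb{Z}}x^n$. A *weak quantum vertex algebra* is a vector space $V$ with a linear map $Y(\cdot,x):V\to(\mathrm{End}\,V)[[x,x^{-1}]]$ and a vector $\mathbf 1\in V$ such that $Y(u,x)v\in V((x))$, $Y(\mathbf 1,x)v=v$, $Y(u,x)\mathbf 1\in V[[x]]$ and $\lim_{x\to0}Y(u,x)\mathbf 1=u$ for all $u,v\in V$, and such that for all $u,v\in V$ there are finitely many $u^{(i)},v^{(i)}\in V$, $f_i(x)\in\mathbb{C}((x))$ with $$x_0^{-1}\delta\Big(\frac{x_1-x_2}{x_0}\Big)Y(u,x_1)Y(v,x_2)-x_0^{-1}\delta\Big(\frac{x_2-x_1}{-x_0}\Big)\sum_i f_i(x_2-x_1)Y(v^{(i)},x_2)Y(u^{(i)},x_1)=x_2^{-1}\delta\Big(\frac{x_1-x_0}{x_2}\Big)Y(Y(u,x_0)v,x_2).$$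 It is said to have *a constant map $\mathcal S$* if there is a linear map $\mathcal S:V\otimes V\to V\otimes V$ such that for all $u,v\in V$ this identity holds with $\mathcal S(v\otimes u)=\sum_i v^{(i)}\otimes u^{(i)}$ and all $f_i=1$. Put $\mathcal D v=\lim_{x\to0}\frac{d}{dx}Y(v,x)\mathbf 1$; the *opposite algebra* is $V^o=(V,Y^o,\mathbf 1)$ with $Y^o(u,x)v=e^{x\mathcal D}Y(v,-x)u$. Let $\phi(x,z)\in\mathbb{C}((x))[[z]]$ be one of $x+z$ and $\frac{x}{1+zx}$ (expanded in nonnegative powers of $z$). A *$\phi$-coordinated $V$-module* is a vector space $W$ with a linear map $Y_W(\cdot,x):V\to(\mathrm{End}\,W)[[x,x^{-1}]]$ such that $Y_W(v,x)w\in W((x))$ for all $v\in V$, $w\in W$, $Y_W(\mathbf 1,x)=1_W$, and for all $u,v\in V$ there is $k\in\mathbb{N}$ with $(x_1-x_2)^kY_W(u,x_1)Y_W(v,x_2)\in\mathrm{Hom}(W,W((x_1,x_2)))$ and $$\big((x_1-x_2)^kY_W(u,x_1)Y_W(v,x_2)\big)\big|_{x_1=\phi(x_2,z)}=(\phi(x_2,z)-x_2)^kY_W(Y(u,z)v,x_2).$$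 A *$V$-module* is a $\phi$-coordinated $V$-module with $\phi(x,z)=x+z$. **Theorem.** Let $V$ be a weak quantum vertex algebra with a constant map $\mathcal S$, and let $(W,Y_W)$ be a $V$-module. Define $Y_W^*(\cdot,x):V\to(\mathrm{End}\,W^*)[[x,x^{-1}]]$ by $\langle Y_W^*(v,x)\alpha,w\rangle=\langle\alpha,Y_W(v,x^{-1})w\rangle$ for $v\in V$, $\alpha\in W^*$, $w\in W$, and let $D(W)$ be the subspace of all $\alpha\in W^*$ with $Y_W^*(v,x)\alpha\in W^*((x))$ for every $v\in V$. Then $$Y_W^*(v,x)\alpha\in D(W)((x))\quad\text{for all }v\in V,\ \alpha\in D(W).$$ Furthermore, $V^o$ is a weak quantum vertex algebra, and $(D(W),Y_W^*)$ is a $\phi$-coordinated $V^o$-module with $\phi(x,z)=\frac{x}{1+zx}$. -/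

import Mathlib

open scoped TensorProduct

noncomputable section

/-!
Formal series in `U[[x, x⁻¹]]` are functions `ℤ → U`; the value at `n` is the coefficient of `x ^ n`.
A vertex operator map `Y(·, x) : V → (End W)[[x, x⁻¹]]` is a linear map
`Y : V →ₗ[ℂ] (ℤ → Module.End ℂ W)`; so `Y v n w` is the coefficient of `x ^ n` in `Y(v, x) w`.
All infinite sums below (`∑ᶠ`) have finitely many nonzero terms on the objects considered.
-/

namespace WQVA

/-- `f ∈ U((x))`: only finitely many negative powers of `x` occur. -/
def IsLaurent {U : Type*} [Zero U] (f : ℤ → U) : Prop :=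
  ∃ N : ℤ, ∀ n < N, f n = 0

/-- `A ∈ U((x₁, x₂)) = U[[x₁, x₂]][x₁⁻¹, x₂⁻¹]`; `A m n` is the coefficient of `x₁ ^ m * x₂ ^ n`. -/
def IsLaurent₂ {U : Type*} [Zero U] (A : ℤ → ℤ → U) : Prop :=
  ∃ N : ℤ, ∀ m n : ℤ, (m < N ∨ n < N) → A m n = 0

/-- The coefficient of `x ^ (n - i) * y ^ i` in `(x - y) ^ n`, expanded in nonnegative powers
of `y`, for an arbitrary integer `n`. -/
def subPowCoeff (n : ℤ) (i : ℕ) : ℂ :=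
  (-1) ^ i * ((Ring.choose n i : ℤ) : ℂ)

section Algebra

variable {V : Type*} [AddCommGroup V] [Module ℂ V]

/-- The coefficient of `x₀ ^ a * x₁ ^ b * x₂ ^ c` in
`x₀⁻¹ δ((x₁ - x₂) / x₀) Y(u, x₁) Y(v, x₂) w`,
where `x₀⁻¹ δ((x₁ - x₂) / x₀) = ∑ₙ x₀ ^ (-n-1) * (x₁ - x₂) ^ n` (so `n = -a-1`). -/
def jacobiLeft₁ (Y : V →ₗ[ℂ] (ℤ → Module.End ℂ V)) (u v w : V) (a b c : ℤ) : V :=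
  ∑ᶠ i : ℕ, subPowCoeff (-a - 1) i • Y u (b - (-a - 1 - i)) (Y v (c - i) w)

/-- The coefficient of `x₀ ^ a * x₁ ^ b * x₂ ^ c` in
`x₀⁻¹ δ((x₂ - x₁) / (-x₀)) f(x₂ - x₁) Y(v, x₂) Y(u, x₁) w`, where
`x₀⁻¹ δ((x₂ - x₁) / (-x₀)) = ∑ₙ (-1) ^ n * x₀ ^ (-n-1) * (x₂ - x₁) ^ n` (so `n = -a-1`).
The index `m` runs over the terms of `f(x) = ∑ₘ fₘ x ^ m`. -/
def jacobiLeft₂ (Y : V →ₗ[ℂ] (ℤ → Module.End ℂ V)) (f : LaurentSeries ℂ) (u v w : V)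
    (a b c : ℤ) : V :=
  (-1 : ℂ) ^ (-a - 1) • ∑ᶠ p : ℤ × ℕ,
    (f.coeff p.1 * subPowCoeff (-a - 1 + p.1) p.2) •
      Y v (c - (-a - 1 + p.1 - p.2)) (Y u (b - p.2) w)

/-- The coefficient of `x₀ ^ a * x₁ ^ b * x₂ ^ c` in
`x₂⁻¹ δ((x₁ - x₀) / x₂) Y(Y(u, x₀) v, x₂) w`, where
`x₂⁻¹ δ((x₁ - x₀) / x₂) = ∑ₙ x₂ ^ (-n-1) * (x₁ - x₀) ^ n` (so `n = b + i`). -/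
def jacobiRight (Y : V →ₗ[ℂ] (ℤ → Module.End ℂ V)) (u v w : V) (a b c : ℤ) : V :=
  ∑ᶠ i : ℕ, subPowCoeff (b + i) i • Y (Y u (a - i) v) (c + (b + i) + 1) w

/-- The `S`-Jacobi identity for `u, v`, with vectors `u⁽ⁱ⁾ = u' i`, `v⁽ⁱ⁾ = v' i` and
series `fᵢ(x) = f i`. -/
def SJacobi (Y : V →ₗ[ℂ] (ℤ → Module.End ℂ V)) (u v : V) {r : ℕ} (u' v' : Fin r → V)
    (f : Fin r → LaurentSeries ℂ) : Prop :=
  ∀ (w : V) (a b c : ℤ),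
    jacobiLeft₁ Y u v w a b c - ∑ i, jacobiLeft₂ Y (f i) (u' i) (v' i) w a b c
      = jacobiRight Y u v w a b c

/-- `(V, Y, 𝟏)` is a weak quantum vertex algebra. -/
structure IsWeakQuantumVertexAlgebra (Y : V →ₗ[ℂ] (ℤ → Module.End ℂ V)) (one : V) : Prop where
  truncation : ∀ u v : V, IsLaurent fun n => Y u n v
  /-- `Y(𝟏, x) v = v` -/
  vacuum : Y one = Pi.single 0 1
  /-- `Y(u, x) 𝟏 ∈ V[[x]]` -/
  creation : ∀ (u : V), ∀ n < 0, Y u n one = 0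
  /-- `lim_{x → 0} Y(u, x) 𝟏 = u` -/
  creation_limit : ∀ u : V, Y u 0 one = u
  jacobi : ∀ u v : V, ∃ (r : ℕ) (u' v' : Fin r → V) (f : Fin r → LaurentSeries ℂ),
    SJacobi Y u v u' v' f

/-- There is a linear map `S : V ⊗ V → V ⊗ V`, not depending on `x`, such that the `S`-Jacobi
identity holds with `S(v ⊗ u) = ∑ᵢ v⁽ⁱ⁾ ⊗ u⁽ⁱ⁾` and `fᵢ(x) = 1`. -/
def HasConstantS (Y : V →ₗ[ℂ] (ℤ → Module.End ℂ V)) : Prop :=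
  ∃ S : V ⊗[ℂ] V →ₗ[ℂ] V ⊗[ℂ] V, ∀ u v : V, ∃ (r : ℕ) (u' v' : Fin r → V),
    S (v ⊗ₜ[ℂ] u) = ∑ i, v' i ⊗ₜ[ℂ] u' i ∧ SJacobi Y u v u' v' (fun _ => 1)

/-- The operator `𝒟 v = lim_{x → 0} (d/dx) Y(v, x) 𝟏`. -/
def derivOp (Y : V →ₗ[ℂ] (ℤ → Module.End ℂ V)) (one : V) : Module.End ℂ V where
  toFun v := Y v 1 one
  map_add' u v := by simp
  map_smul' c v := by simp

/-- The `i`-th term of the coefficient of `x ^ n` in `exp(x 𝒟) Y(v, -x) u`. -/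
def oppositeTerm (Y : V →ₗ[ℂ] (ℤ → Module.End ℂ V)) (one : V) (u v : V) (n : ℤ) (i : ℕ) : V :=
  ((i.factorial : ℂ)⁻¹ * (-1 : ℂ) ^ (n - i)) • (derivOp Y one ^ i) (Y v (n - i) u)

theorem oppositeTerm_finite {Y : V →ₗ[ℂ] (ℤ → Module.End ℂ V)}
    (hY : ∀ u v : V, IsLaurent fun n => Y u n v) (one u v : V) (n : ℤ) :
    (Function.support (oppositeTerm Y one u v n)).Finite := by
  obtain ⟨N, hN⟩ := hY v u
  refine (Set.finite_Iic (n - N).toNat).subset fun i hi => ?_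
  by_contra h
  simp only [Set.mem_Iic, not_le] at h
  apply hi
  have : Y v (n - i) u = 0 := hN _ (by omega)
  simp [oppositeTerm, this]

/-- The vertex operator map of the opposite algebra: `Yᵒ(u, x) v = exp(x 𝒟) Y(v, -x) u`. -/
def oppositeY (Y : V →ₗ[ℂ] (ℤ → Module.End ℂ V)) (one : V)
    (hY : ∀ u v : V, IsLaurent fun n => Y u n v) : V →ₗ[ℂ] (ℤ → Module.End ℂ V) where
  toFun u n :=
    { toFun := fun v => ∑ᶠ i : ℕ, oppositeTerm Y one u v n i
      map_add' := fun v v' => by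
        rw [← finsum_add_distrib (oppositeTerm_finite hY one u v n)
          (oppositeTerm_finite hY one u v' n)]
        exact finsum_congr fun i => by simp [oppositeTerm]
      map_smul' := fun c v => by
        rw [RingHom.id_apply, smul_finsum' c (oppositeTerm_finite hY one u v n)]
        exact finsum_congr fun i => by simp [oppositeTerm, smul_comm c] }
  map_add' u u' := by
    ext n v
    change ∑ᶠ i : ℕ, oppositeTerm Y one (u + u') v n i =
      ∑ᶠ i : ℕ, oppositeTerm Y one u v n i + ∑ᶠ i : ℕ, oppositeTerm Y one u' v n i
    rw [← finsum_add_distrib (oppositeTerm_finite hY one u v n)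
      (oppositeTerm_finite hY one u' v n)]
    exact finsum_congr fun i => by simp [oppositeTerm]
  map_smul' c u := by
    ext n v
    change ∑ᶠ i : ℕ, oppositeTerm Y one (c • u) v n i = c • ∑ᶠ i : ℕ, oppositeTerm Y one u v n i
    rw [smul_finsum' c (oppositeTerm_finite hY one u v n)]
    exact finsum_congr fun i => by simp [oppositeTerm, smul_comm c]

end Algebra

section Coordinates

/-- The variable `x` of `ℂ((x))`, viewed in `ℂ((x))[[z]]`. -/
def varX : PowerSeries (LaurentSeries ℂ) := PowerSeries.C (HahnSeries.single 1 1)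

/-- The variable `z` of `ℂ((x))[[z]]`. -/
def varZ : PowerSeries (LaurentSeries ℂ) := PowerSeries.X

/-- `φ(x, z) = x + z`. -/
def phiAdd : PowerSeries (LaurentSeries ℂ) := varX + varZ

/-- `φ(x, z) = x / (1 + z x)`, expanded in nonnegative powers of `z`. -/
def phiStar : PowerSeries (LaurentSeries ℂ) := varX * (1 + varZ * varX)⁻¹

/-- The integer powers `φ(x, z) ^ m` of a `φ ∈ ℂ((x))[[z]]` with `φ(x, 0) ≠ 0`. -/
def phiPow (φ : PowerSeries (LaurentSeries ℂ)) : ℤ → PowerSeries (LaurentSeries ℂ)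
  | Int.ofNat m => φ ^ m
  | Int.negSucc m => φ⁻¹ ^ (m + 1)

/-- The coefficient of `z ^ j * x ^ q` (for `j q : ℤ`) in an element of `ℂ((x))[[z]]`. -/
def zxCoeff (F : PowerSeries (LaurentSeries ℂ)) (j q : ℤ) : ℂ :=
  if 0 ≤ j then (PowerSeries.coeff j.toNat F).coeff q else 0

end Coordinates

section Modules

variable {V : Type*} [AddCommGroup V] [Module ℂ V] {W : Type*} [AddCommGroup W] [Module ℂ W]

/-- The coefficient of `x₁ ^ m * x₂ ^ n` in `(x₁ - x₂) ^ k Y_W(u, x₁) Y_W(v, x₂) w`. -/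
def mulPowCoeff (YW : V →ₗ[ℂ] (ℤ → Module.End ℂ W)) (k : ℕ) (u v : V) (w : W) (m n : ℤ) : W :=
  ∑ i ∈ Finset.range (k + 1),
    ((-1 : ℂ) ^ i * (k.choose i : ℂ)) • YW u (m - (k - i)) (YW v (n - i) w)

/-- The coefficient of `z ^ j * x₂ ^ c` in `A(x₁, x₂)|_{x₁ = φ(x₂, z)}`, for
`A(x₁, x₂) ∈ W((x₁, x₂))` and `φ ∈ ℂ((x))[[z]]` with `φ(x, 0) = x`. -/
def substCoeff (φ : PowerSeries (LaurentSeries ℂ)) (A : ℤ → ℤ → W) (j c : ℤ) : W :=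
  ∑ᶠ p : ℤ × ℤ, zxCoeff (phiPow φ p.1) j (c - p.2) • A p.1 p.2

/-- The coefficient of `z ^ j * x₂ ^ c` in `F(x₂, z) Y_W(Y(u, z) v, x₂) w`, for
`F ∈ ℂ((x))[[z]]`. -/
def iterateCoeff (Y : V →ₗ[ℂ] (ℤ → Module.End ℂ V)) (YW : V →ₗ[ℂ] (ℤ → Module.End ℂ W))
    (F : PowerSeries (LaurentSeries ℂ)) (u v : V) (w : W) (j c : ℤ) : W :=
  ∑ᶠ p : ℤ × ℤ, zxCoeff F p.1 p.2 • YW (Y u (j - p.1) v) (c - p.2) w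

/-- `(W, Y_W)` is a `φ`-coordinated module for the weak quantum vertex algebra `(V, Y, 𝟏)`. -/
structure IsPhiCoordinatedModule (φ : PowerSeries (LaurentSeries ℂ))
    (Y : V →ₗ[ℂ] (ℤ → Module.End ℂ V)) (one : V)
    (YW : V →ₗ[ℂ] (ℤ → Module.End ℂ W)) : Prop where
  truncation : ∀ (v : V) (w : W), IsLaurent fun n => YW v n w
  /-- `Y_W(𝟏, x) = 1_W` -/
  vacuum : YW one = Pi.single 0 1
  /-- For some `k`, `(x₁ - x₂)ᵏ Y_W(u, x₁) Y_W(v, x₂) ∈ Hom(W, W((x₁, x₂)))`, and its value at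
  `x₁ = φ(x₂, z)` is `(φ(x₂, z) - x₂)ᵏ Y_W(Y(u, z) v, x₂)`. -/
  assoc : ∀ u v : V, ∃ k : ℕ,
    (∀ w : W, IsLaurent₂ (mulPowCoeff YW k u v w)) ∧
    ∀ (w : W) (j c : ℤ),
      substCoeff φ (mulPowCoeff YW k u v w) j c = iterateCoeff Y YW ((φ - varX) ^ k) u v w j c

/-- A module for a weak quantum vertex algebra: the case `φ(x, z) = x + z`. -/
def IsModule (Y : V →ₗ[ℂ] (ℤ → Module.End ℂ V)) (one : V)
    (YW : V →ₗ[ℂ] (ℤ → Module.End ℂ W)) : Prop :=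
  IsPhiCoordinatedModule phiAdd Y one YW

/-- `Y_W^*(·, x) : V → (End W^*)[[x, x⁻¹]]`, `⟨Y_W^*(v, x) α, w⟩ = ⟨α, Y_W(v, x⁻¹) w⟩`. -/
def dualY (YW : V →ₗ[ℂ] (ℤ → Module.End ℂ W)) :
    V →ₗ[ℂ] (ℤ → Module.End ℂ (Module.Dual ℂ W)) where
  toFun v n := Module.Dual.transpose (R := ℂ) (YW v (-n))
  map_add' u v := by ext; simp [Module.Dual.transpose_apply]
  map_smul' c v := by ext; simp [Module.Dual.transpose_apply]

/-- `D(W)`: the subspace of all `α ∈ W^*` with `Y_W^*(v, x) α ∈ W^*((x))` for every `v`. -/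
def dualSpace (YW : V →ₗ[ℂ] (ℤ → Module.End ℂ W)) : Submodule ℂ (Module.Dual ℂ W) where
  carrier := {α | ∀ v : V, IsLaurent fun n => dualY YW v n α}
  zero_mem' v := ⟨0, fun n _ => by simp⟩
  add_mem' {α β} hα hβ v := by
    obtain ⟨M, hM⟩ := hα v
    obtain ⟨N, hN⟩ := hβ v
    refine ⟨min M N, fun n hn => ?_⟩
    have h₁ := hM n (lt_of_lt_of_le hn (min_le_left _ _))
    have h₂ := hN n (lt_of_lt_of_le hn (min_le_right _ _))
    simp only at h₁ h₂
    simp [h₁, h₂]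
  smul_mem' c α hα v := by
    obtain ⟨M, hM⟩ := hα v
    refine ⟨M, fun n hn => ?_⟩
    have h₁ := hM n hn
    simp only at h₁
    simp [h₁]

/-- Restriction of a vertex operator map to a subspace that is stable under all coefficients. -/
def restrictY (YW : V →ₗ[ℂ] (ℤ → Module.End ℂ W)) (U : Submodule ℂ W)
    (h : ∀ (v : V) (n : ℤ), ∀ w ∈ U, YW v n w ∈ U) : V →ₗ[ℂ] (ℤ → Module.End ℂ U) where
  toFun v n := (YW v n).restrict (h v n)
  map_add' u v := by ext; simp
  map_smul' c v := by ext; simp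

end Modules

end WQVA

end

/-!
Multiplying by a high power of `x₁ - x₂` and expanding at `x₁ = x₂ + z` turns
`Y_W(u, x₁) Y_W(v, x₂)` into `z ^ k Y_W(Y(u, z) v, x₂)`, and an element of `W((x₁, x₂))` is
determined by this expansion. Exchanging `x₁` and `x₂` gives the same expansion for `Yᵒ`, because
`Y_W(Yᵒ(v, z) u, x) = Y_W(Y(u, -z) v, x + z)`. For a constant `S`, the `S`-locality of `V` therefore
says that `Yᵒ(v, z) u = ∑ᵢ Y(v⁽ⁱ⁾, z) u⁽ⁱ⁾`. This is an identity in `V` alone, and it implies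
`S`-locality on every module. It follows that `S`-locality passes from `V` to every module and, as
`(Vᵒ)ᵒ = V`, to `Vᵒ`.

On `W^*` the substitution `x ↦ x⁻¹` reverses products, so `Y_W^*` is again `S`-local. Locality
bounds the poles of `(x₁ - x₂) ^ k Y_W^*(u, x₁) Y_W^*(v, x₂) α` in both variables for `α ∈ D(W)`,
which is the stability of `D(W)`. Finally `1 / (x₂ / (1 + z x₂)) = x₂⁻¹ + z`, so the substitution
defining a `φ`-coordinated module becomes the expansion of `Y_W` at `x₁⁻¹ = x₂⁻¹ + z`.
-/

noncomputable section

namespace WQVA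

open Function (support swap)

/-! ### Binomial coefficients with integer entries -/

/-- The binomial coefficient `n.choose j` for integers `n` and `j`. The convention that it is `0`
for `j < 0` makes it the coefficient of `t ^ j` in `(1 + t) ^ n` for every integer `j`. -/
def zchoose (n j : ℤ) : ℂ := if 0 ≤ j then ((Ring.choose n j.toNat : ℤ) : ℂ) else 0

theorem zchoose_natCast (n : ℤ) (j : ℕ) : zchoose n j = ((Ring.choose n j : ℤ) : ℂ) := by
  simp [zchoose]

theorem zchoose_of_neg (n : ℤ) {j : ℤ} (h : j < 0) : zchoose n j = 0 := by
  simp [zchoose, not_le.2 h]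

@[simp] theorem zchoose_zero_right (n : ℤ) : zchoose n 0 = 1 := by simp [zchoose]

theorem zchoose_natCast_natCast (n j : ℕ) : zchoose n j = (n.choose j : ℂ) := by
  rw [zchoose_natCast, Ring.choose_natCast, Int.cast_natCast]

theorem zchoose_zero_left (j : ℤ) : zchoose 0 j = if j = 0 then 1 else 0 := by
  rcases lt_or_ge j 0 with h | h
  · rw [zchoose_of_neg _ h, if_neg h.ne]
  · lift j to ℕ using h
    rw [zchoose_natCast, Ring.choose_zero_ite]
    split_ifs <;> simp_all

theorem zchoose_add_one (n j : ℤ) : zchoose (n + 1) j = zchoose n (j - 1) + zchoose n j := by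
  rcases lt_or_ge j 0 with h | h
  · rw [zchoose_of_neg _ h, zchoose_of_neg _ h, zchoose_of_neg _ (by lia), add_zero]
  · lift j to ℕ using h
    cases j with
    | zero => simp [zchoose_of_neg n neg_one_lt_zero]
    | succ j =>
      rw [Nat.cast_succ, add_sub_cancel_right, ← Nat.cast_succ]
      simp only [zchoose_natCast, Ring.choose_succ_succ, Int.cast_add]

theorem subPowCoeff_eq (n : ℤ) (i : ℕ) : subPowCoeff n i = (-1) ^ i * zchoose n i := by
  rw [subPowCoeff, zchoose_natCast]

theorem zchoose_neg (n j : ℤ) : zchoose n j = (-1) ^ j * zchoose (j - n - 1) j := by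
  rcases lt_or_ge j 0 with h | h
  · rw [zchoose_of_neg _ h, zchoose_of_neg _ h, mul_zero]
  · lift j to ℕ using h
    have := Ring.choose_neg' (-n) j
    rw [neg_neg] at this
    rw [zchoose_natCast, zchoose_natCast, this, Ring.multichoose_eq,
      show -n + (j : ℤ) - 1 = j - n - 1 by ring]
    rcases Nat.even_or_odd j with h | h <;>
      simp [h.neg_one_pow, Int.negOnePow_even, Int.negOnePow_odd, h, Units.smul_def]

theorem zchoose_symm {n : ℤ} (hn : 0 ≤ n) (j : ℤ) : zchoose n (n - j) = zchoose n j := by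
  lift n to ℕ using hn
  rcases lt_or_ge j 0 with h | h
  · rw [zchoose_of_neg _ h, show (n : ℤ) - j = ((n + (-j).toNat : ℕ) : ℤ) by lia,
      zchoose_natCast_natCast, Nat.choose_eq_zero_of_lt (by lia), Nat.cast_zero]
  · lift j to ℕ using h
    rcases lt_or_ge n j with h | h
    · rw [zchoose_of_neg _ (by lia), zchoose_natCast_natCast, Nat.choose_eq_zero_of_lt h,
        Nat.cast_zero]
    · rw [← Nat.cast_sub h, zchoose_natCast_natCast, zchoose_natCast_natCast, Nat.choose_symm h]

theorem zchoose_eq_zero_of_lt {n j : ℤ} (hn : 0 ≤ n) (h : n < j) : zchoose n j = 0 := by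
  rw [← zchoose_symm hn, zchoose_of_neg _ (by lia)]

theorem neg_one_zpow_congr {m n : ℤ} (h : Even (m - n)) : (-1 : ℂ) ^ m = (-1) ^ n := by
  rw [← sub_add_cancel m n, zpow_add₀ (by norm_num), h.neg_one_zpow, one_mul]

theorem neg_one_zpow_add (m n : ℤ) : (-1 : ℂ) ^ (m + n) = (-1) ^ m * (-1) ^ n :=
  zpow_add₀ (by norm_num) m n

theorem neg_one_zpow_sub (m n : ℤ) : (-1 : ℂ) ^ (m - n) = (-1) ^ m * (-1) ^ n := by
  rw [← neg_one_zpow_add]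
  exact neg_one_zpow_congr ⟨-n, by ring⟩

theorem neg_one_zpow_mul_self (n : ℤ) : (-1 : ℂ) ^ n * (-1) ^ n = 1 := by
  rw [← mul_zpow, neg_one_mul, neg_neg, one_zpow]

/-- The two expansions of `(1 - t) ^ N` at `0` and `∞` differ, up to sign, by an expansion of a
delta function; this is the comparison of the coefficients of `t ^ r`. -/
theorem zchoose_residue (N r : ℤ) :
    (-1) ^ (N - r) * (zchoose N (N - r) - zchoose N r) = zchoose (-r - 1) (-N - 1) := by
  have h₁ : (-1) ^ (N - r) * zchoose N (N - r) = zchoose (-r - 1) (N - r) := by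
    rw [zchoose_neg N, ← mul_assoc, neg_one_zpow_mul_self, one_mul]
    congr 1; ring
  have h₂ : (-1) ^ (N - r) * zchoose N r = (-1) ^ N * zchoose (r - N - 1) r := by
    rw [zchoose_neg N r, ← mul_assoc, neg_one_zpow_sub, mul_assoc ((-1) ^ N),
      neg_one_zpow_mul_self, mul_one]
  rcases lt_or_ge r 0 with hr | hr
  · rw [zchoose_of_neg N hr, sub_zero, h₁, ← zchoose_symm (by lia)]
    congr 1; ring
  rcases lt_or_ge N 0 with hN | hN
  · rw [zchoose_of_neg N (by lia), zero_sub, mul_neg, h₂, zchoose_neg (-r - 1),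
      show -N - 1 - (-r - 1) - 1 = r - N - 1 by ring, ← zchoose_symm (by lia : 0 ≤ r - N - 1) r,
      show r - N - 1 - r = -N - 1 by ring, ← neg_mul, neg_one_zpow_sub,
      neg_one_zpow_congr (m := N) (n := -N) ⟨N, by ring⟩, zpow_one, mul_neg_one]
  · rw [zchoose_symm hN, sub_self, mul_zero, zchoose_of_neg _ (by lia)]

theorem finite_support_mul_zchoose_sub (f : ℕ → ℂ) (b j : ℤ) :
    (support fun i : ℕ => f i * zchoose b (j - i)).Finite := by
  refine (Set.finite_Iic j.toNat).subset fun i hi => ?_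
  by_contra h
  rw [Set.mem_Iic, not_le] at h
  exact hi (by simp only [zchoose_of_neg b (show j - i < 0 by lia), mul_zero])

theorem finsum_zchoose_mul_zchoose (a b j : ℤ) :
    ∑ᶠ i : ℕ, zchoose a i * zchoose b (j - i) = zchoose (a + b) j := by
  rcases lt_or_ge j 0 with h | h
  · simp only [zchoose_of_neg _ h, zchoose_of_neg b (show j - (_ : ℕ) < 0 by lia), mul_zero,
      finsum_zero]
  lift j to ℕ using h
  rw [zchoose_natCast, Ring.add_choose_eq j (Commute.all a b),
    Finset.Nat.sum_antidiagonal_eq_sum_range_succ_mk,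
    finsum_eq_sum_of_support_subset (s := Finset.range (j + 1)), Int.cast_sum]
  · refine Finset.sum_congr rfl fun i hi => ?_
    rw [← Nat.cast_sub (Finset.mem_range_succ_iff.1 hi), zchoose_natCast, zchoose_natCast,
      Int.cast_mul]
  · intro i hi
    by_contra h
    rw [Finset.coe_range, Set.mem_Iio, not_lt] at h
    exact hi (by simp only [zchoose_of_neg b (show (j : ℤ) - i < 0 by lia), mul_zero])

theorem finsum_zchoose_mul_zchoose_add (l : ℕ) (b j : ℤ) :
    ∑ᶠ i : ℕ, zchoose l i * zchoose b (j + i) = zchoose (b + l) (j + l) := by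
  have hsupp : ∀ f : ℕ → ℂ, support (fun i : ℕ => zchoose l i * f i) ⊆ Finset.range (l + 1) :=
    fun f i hi => by
      by_contra h
      rw [Finset.coe_range, Set.mem_Iio, not_lt] at h
      exact hi (by simp only [zchoose_eq_zero_of_lt l.cast_nonneg (show (l : ℤ) < i by lia),
        zero_mul])
  rw [add_comm b, ← finsum_zchoose_mul_zchoose, finsum_eq_sum_of_support_subset _ (hsupp _),
    finsum_eq_sum_of_support_subset _ (hsupp _), ← Finset.sum_range_reflect]
  refine Finset.sum_congr rfl fun i hi => ?_
  have hi : ((l + 1 - 1 - i : ℕ) : ℤ) = l - i := by have := Finset.mem_range.1 hi; lia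
  rw [hi, zchoose_symm l.cast_nonneg, add_sub_assoc]

theorem fwdDiff_iter_zchoose (Q : ℕ) (j : ℤ) :
    (fwdDiff (1 : ℤ))^[Q] (zchoose · j) = (zchoose · (j - Q)) := by
  induction Q with
  | zero => simp
  | succ Q ih =>
    rw [Function.iterate_succ_apply', ih]
    ext x
    rw [fwdDiff, zchoose_add_one, add_sub_cancel_right]
    congr 1; push_cast; ring

theorem finsum_fwdDiff_zchoose (Q : ℕ) (x j : ℤ) :
    ∑ᶠ n : ℤ, ((-1) ^ (x - n + Q) * zchoose Q (x - n + Q)) * zchoose n j = zchoose x (j - Q) := by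
  have key := congrFun (fwdDiff_iter_zchoose Q j) x
  rw [fwdDiff_iter_eq_sum_shift] at key
  rw [← key, ← finsum_comp_equiv (Equiv.addLeft x),
    finsum_eq_sum_of_support_subset
      (s := (Finset.range (Q + 1)).map ⟨((↑) : ℕ → ℤ), Nat.cast_injective⟩), Finset.sum_map]
  · refine Finset.sum_congr rfl fun i hi => ?_
    have hi := Finset.mem_range_succ_iff.1 hi
    have hsub : x - (x + i) + Q = ((Q - i : ℕ) : ℤ) := by lia
    simp only [Function.Embedding.coeFn_mk, Equiv.coe_addLeft, hsub, zpow_natCast,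
      zchoose_natCast_natCast, Nat.choose_symm hi, zsmul_eq_mul, nsmul_one]
    push_cast; rfl
  · intro n hn
    by_contra h
    refine hn ?_
    have : x - (x + n) + Q < 0 ∨ (Q : ℤ) < x - (x + n) + Q := by
      by_contra! h'
      refine h ?_
      simp only [Finset.coe_map, Set.mem_image, Function.Embedding.coeFn_mk, Finset.coe_range,
        Set.mem_Iio]
      exact ⟨n.toNat, by lia, by lia⟩
    rcases this with h | h
    · simp only [Equiv.coe_addLeft, zchoose_of_neg _ h]; ring
    · simp only [Equiv.coe_addLeft, zchoose_eq_zero_of_lt Q.cast_nonneg h]; ring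

/-! ### Coefficient sums along the lines of constant total degree -/

theorem finsum_comp_of_injective {ι κ M : Type*} [AddCommMonoid M] {e : ι → κ}
    (he : Function.Injective e) {f : κ → M} (hf : support f ⊆ Set.range e) :
    ∑ᶠ i, f (e i) = ∑ᶠ x, f x := by
  rw [← finsum_mem_range he, ← finsum_mem_univ f]
  refine finsum_mem_inter_support_eq f _ _ ?_
  rw [Set.univ_inter, Set.inter_eq_right.2 hf]

section LineSum

variable {U : Type*} [AddCommGroup U] [Module ℂ U] {A : ℤ → ℤ → U}

/-- The weighted sum of the coefficients of total degree `d` in `A(x₁, x₂)`, where the coefficient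
of `x₁ ^ m * x₂ ^ (d - m)` has weight `f m`. Multiplying `A` by a power of `x₁ - x₂` and
substituting for `x₁` both lead to such sums. -/
def lineSum (A : ℤ → ℤ → U) (d : ℤ) (f : ℤ → ℂ) : U := ∑ᶠ m : ℤ, f m • A m (d - m)

theorem lineSum_congr {d : ℤ} {f g : ℤ → ℂ} (h : ∀ m, A m (d - m) ≠ 0 → f m = g m) :
    lineSum A d f = lineSum A d g := by
  refine finsum_congr fun m => ?_
  by_cases hm : A m (d - m) = 0
  · rw [hm, smul_zero, smul_zero]
  · rw [h m hm]

theorem smul_lineSum (r : ℂ) (A : ℤ → ℤ → U) (d : ℤ) (f : ℤ → ℂ) :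
    r • lineSum A d f = lineSum A d (r • f) := by
  simp only [lineSum, smul_finsum, smul_smul, Pi.smul_apply, smul_eq_mul]

theorem lineSum_smul (A : ℤ → ℤ → U) (r : ℂ) (d : ℤ) (f : ℤ → ℂ) :
    lineSum (r • A) d f = r • lineSum A d f := by
  simp only [lineSum, smul_finsum, Pi.smul_apply, smul_comm r]

theorem lineSum_swap (A : ℤ → ℤ → U) (d : ℤ) (f : ℤ → ℂ) :
    lineSum (swap A) d f = lineSum A d fun m => f (d - m) := by
  rw [lineSum, ← finsum_comp_equiv (Equiv.subLeft d)]
  simp only [Equiv.subLeft_apply, swap, sub_sub_cancel, lineSum]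

theorem lineSum_reflect (A : ℤ → ℤ → U) (k d : ℤ) (f : ℤ → ℂ) :
    lineSum (fun m n => A (k - m) (k - n)) d f = lineSum A (2 * k - d) fun m => f (k - m) := by
  rw [lineSum, ← finsum_comp_equiv (Equiv.subLeft k)]
  refine finsum_congr fun m => ?_
  rw [Equiv.subLeft_apply, sub_sub_cancel, show k - (d - (k - m)) = 2 * k - d - m by ring]

theorem lineSum_single (g : ℤ → U) (d : ℤ) (f : ℤ → ℂ) :
    lineSum (Pi.single 0 g) d f = f 0 • g (d - 0) := by
  rw [lineSum, finsum_eq_single _ 0 fun m hm => by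
    rw [Pi.single_eq_of_ne hm, Pi.zero_apply, smul_zero], Pi.single_eq_same]

theorem finsum_lineSum {ι : Type*} {d : ℤ} {F : ι → ℤ → ℂ}
    (hA : {m | A m (d - m) ≠ 0 ∧ ∃ i, F i m ≠ 0}.Finite)
    (hF : ∀ m, A m (d - m) ≠ 0 → (support fun i => F i m).Finite) :
    ∑ᶠ i, lineSum A d (F i) = lineSum A d fun m => ∑ᶠ i, F i m := by
  have hsum : ∀ f : ℤ → ℂ, (∀ m, f m ≠ 0 → ∃ i, F i m ≠ 0) →
      lineSum A d f = ∑ m ∈ hA.toFinset, f m • A m (d - m) := fun f hf => by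
    refine finsum_eq_sum_of_support_subset _ fun m hm => ?_
    have hm := smul_ne_zero_iff.1 hm
    exact (Set.Finite.mem_toFinset hA).2 ⟨hm.2, hf m hm.1⟩
  have hcurry : ∀ m ∈ hA.toFinset, (support fun i => F i m • A m (d - m)).Finite := fun m hm =>
    (hF m ((Set.Finite.mem_toFinset hA).1 hm).1).subset fun i hi => (smul_ne_zero_iff.1 hi).1
  rw [hsum _ fun m hm => by by_contra! h; exact hm (by simp only [h, finsum_zero]),
    finsum_congr fun i => hsum (F i) fun m hm => ⟨i, hm⟩, finsum_sum_comm _ _ hcurry]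
  simp only [finsum_smul]

end LineSum

/-! ### Laurent series in two variables -/

section TwoVariables

variable {U : Type*} [AddCommGroup U]

/-- The powers of `x₂` in `P(x₁, x₂)` are bounded below, so that `P` may be multiplied by the
expansion of `(x₁ - x₂) ^ n` for every integer `n`. -/
def IsTruncatedRight (P : ℤ → ℤ → U) : Prop := ∃ N : ℤ, ∀ p, ∀ q < N, P p q = 0

theorem IsTruncatedRight.isLaurent₂ {P : ℤ → ℤ → U} (h : IsTruncatedRight P)
    (h' : IsTruncatedRight (swap P)) : IsLaurent₂ P := by
  obtain ⟨N, hN⟩ := h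
  obtain ⟨N', hN'⟩ := h'
  refine ⟨min N N', fun m n hmn => ?_⟩
  simp only [lt_min_iff] at hmn
  exact hmn.elim (fun hm => hN' n m hm.2) fun hn => hN m n hn.1

protected theorem IsTruncatedRight.add {P Q : ℤ → ℤ → U} (hP : IsTruncatedRight P)
    (hQ : IsTruncatedRight Q) : IsTruncatedRight (P + Q) := by
  obtain ⟨N, hN⟩ := hP
  obtain ⟨N', hN'⟩ := hQ
  refine ⟨min N N', fun p q hq => ?_⟩
  rw [lt_min_iff] at hq
  simp only [Pi.add_apply, hN p q hq.1, hN' p q hq.2, add_zero]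

protected theorem IsTruncatedRight.sum {ι : Type*} (s : Finset ι) {P : ι → ℤ → ℤ → U}
    (hP : ∀ i, IsTruncatedRight (P i)) : IsTruncatedRight (∑ i ∈ s, P i) :=
  Finset.sum_induction P IsTruncatedRight (fun _ _ h h' => h.add h') ⟨0, fun _ _ _ => rfl⟩
    fun i _ => hP i

theorem IsLaurent.single {f : ℤ → U} (hf : IsLaurent f) :
    IsLaurent₂ (Pi.single 0 f : ℤ → ℤ → U) := by
  obtain ⟨N, hN⟩ := hf
  refine ⟨min N 0, fun m n h => ?_⟩
  rw [lt_min_iff, lt_min_iff] at h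
  rcases eq_or_ne m 0 with rfl | hm
  · rw [Pi.single_eq_same, hN n (by lia)]
  · rw [Pi.single_eq_of_ne hm, Pi.zero_apply]

namespace IsLaurent₂

variable {A B : ℤ → ℤ → U}

protected theorem swap (hA : IsLaurent₂ A) : IsLaurent₂ (swap A) := by
  obtain ⟨N, hN⟩ := hA
  exact ⟨N, fun m n h => hN n m h.symm⟩

protected theorem sub (hA : IsLaurent₂ A) (hB : IsLaurent₂ B) : IsLaurent₂ (A - B) := by
  obtain ⟨N, hN⟩ := hA
  obtain ⟨N', hN'⟩ := hB
  refine ⟨min N N', fun m n h => ?_⟩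
  simp only [lt_min_iff] at h
  simp only [Pi.sub_apply, hN m n (by lia), hN' m n (by lia), sub_zero]

protected theorem add (hA : IsLaurent₂ A) (hB : IsLaurent₂ B) : IsLaurent₂ (A + B) := by
  obtain ⟨N, hN⟩ := hA
  obtain ⟨N', hN'⟩ := hB
  refine ⟨min N N', fun m n h => ?_⟩
  simp only [lt_min_iff] at h
  simp only [Pi.add_apply, hN m n (by lia), hN' m n (by lia), add_zero]

protected theorem sum {ι : Type*} (s : Finset ι) {A : ι → ℤ → ℤ → U}
    (hA : ∀ i, IsLaurent₂ (A i)) : IsLaurent₂ (∑ i ∈ s, A i) := by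
  refine Finset.sum_induction A IsLaurent₂ (fun _ _ => .add) ⟨0, fun _ _ _ => rfl⟩ fun i _ => hA i

protected theorem smul [Module ℂ U] (hA : IsLaurent₂ A) (r : ℂ) : IsLaurent₂ (r • A) := by
  obtain ⟨N, hN⟩ := hA
  exact ⟨N, fun m n h => by simp only [Pi.smul_apply, hN m n h, smul_zero]⟩

theorem finite_line (hA : IsLaurent₂ A) (d : ℤ) : {m | A m (d - m) ≠ 0}.Finite := by
  obtain ⟨N, hN⟩ := hA
  refine (Set.finite_Icc N (d - N)).subset fun m hm => ?_
  by_contra h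
  rw [Set.mem_Icc, not_and_or] at h
  exact hm (hN m (d - m) (by lia))

protected theorem map (hA : IsLaurent₂ A) {F U' : Type*} [AddCommGroup U'] [FunLike F U U']
    [AddMonoidHomClass F U U'] (T : F) : IsLaurent₂ fun m n => T (A m n) := by
  obtain ⟨N, hN⟩ := hA
  exact ⟨N, fun m n h => by simp only [hN m n h, map_zero]⟩

variable [Module ℂ U]

theorem finite_support_line (hA : IsLaurent₂ A) (d : ℤ) (f : ℤ → ℂ) :
    (support fun m => f m • A m (d - m)).Finite :=
  (hA.finite_line d).subset fun _ hm => (smul_ne_zero_iff.1 hm).2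

theorem finsum_lineSum (hA : IsLaurent₂ A) {ι : Type*} (d : ℤ) {F : ι → ℤ → ℂ}
    (hF : ∀ m, (support fun i => F i m).Finite) :
    ∑ᶠ i, lineSum A d (F i) = lineSum A d fun m => ∑ᶠ i, F i m :=
  WQVA.finsum_lineSum ((hA.finite_line d).subset fun _ hm => hm.1) fun m _ => hF m

theorem lineSum_sub (hA : IsLaurent₂ A) (hB : IsLaurent₂ B) (d : ℤ) (f : ℤ → ℂ) :
    lineSum (A - B) d f = lineSum A d f - lineSum B d f := by
  simp only [lineSum, Pi.sub_apply, smul_sub]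
  exact finsum_sub_distrib (hA.finite_support_line d f) (hB.finite_support_line d f)

theorem lineSum_weight_sub (hA : IsLaurent₂ A) (d : ℤ) (f g : ℤ → ℂ) :
    lineSum A d (f - g) = lineSum A d f - lineSum A d g := by
  simp only [lineSum, Pi.sub_apply, sub_smul]
  exact finsum_sub_distrib (hA.finite_support_line d f) (hA.finite_support_line d g)

theorem map_lineSum (hA : IsLaurent₂ A) {U' : Type*} [AddCommGroup U'] [Module ℂ U']
    (T : U →ₗ[ℂ] U') (d : ℤ) (f : ℤ → ℂ) :
    T (lineSum A d f) = lineSum (fun m n => T (A m n)) d f := by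
  simp only [lineSum, ← map_smul]
  exact T.toAddMonoidHom.map_finsum (hA.finite_support_line d f)

end IsLaurent₂

theorem lineSum_sum [Module ℂ U] {ι : Type*} (s : Finset ι) {A : ι → ℤ → ℤ → U}
    (hA : ∀ i, IsLaurent₂ (A i)) (d : ℤ) (f : ℤ → ℂ) :
    lineSum (∑ i ∈ s, A i) d f = ∑ i ∈ s, lineSum (A i) d f := by
  simp only [lineSum, Finset.sum_apply, Finset.smul_sum]
  exact finsum_sum_comm s _ fun i _ => (hA i).finite_support_line d f

end TwoVariables

section TwoVariables

variable {U : Type*} [AddCommGroup U] [Module ℂ U] {A B P Q : ℤ → ℤ → U}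

/-! ### Taylor coefficients along the diagonal -/

/-- The coefficient of `z ^ j * x₂ ^ c` in `A(x₂ + z, x₂)`. -/
def taylorCoeff (A : ℤ → ℤ → U) (j c : ℤ) : U := lineSum A (c + j) (zchoose · j)

theorem taylorCoeff_smul (A : ℤ → ℤ → U) (r : ℂ) (j c : ℤ) :
    taylorCoeff (r • A) j c = r • taylorCoeff A j c :=
  lineSum_smul A r _ _

theorem taylorCoeff_sum {ι : Type*} (s : Finset ι) {A : ι → ℤ → ℤ → U}
    (hA : ∀ i, IsLaurent₂ (A i)) (j c : ℤ) :
    taylorCoeff (∑ i ∈ s, A i) j c = ∑ i ∈ s, taylorCoeff (A i) j c :=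
  lineSum_sum s hA _ _

theorem lineSum_zchoose_add (hA : IsLaurent₂ A) (a d j : ℤ) :
    lineSum A d (fun m => zchoose (a + m) j) =
      ∑ᶠ i : ℕ, zchoose a i • taylorCoeff A (j - i) (d - (j - i)) := by
  simp only [taylorCoeff, smul_lineSum, sub_add_cancel, ← finsum_zchoose_mul_zchoose a]
  exact (hA.finsum_lineSum d fun m => finite_support_mul_zchoose_sub _ m j).symm

theorem eq_zero_of_taylorCoeff_eq_zero (hA : IsLaurent₂ A) (h : ∀ j c, taylorCoeff A j c = 0) :
    A = 0 := by
  ext m n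
  by_contra hmn
  obtain ⟨N, hN⟩ := id hA
  set d := m + n with hd
  obtain ⟨M, hM, hmax⟩ := Set.exists_max_image _ id (hA.finite_line d)
    ⟨m, by simpa [hd] using hmn⟩
  have hMN : N ≤ M := by by_contra! h; exact hM (hN _ _ (Or.inl h))
  have hzero : lineSum A d (fun p => zchoose (-N + p) (M - N)) = 0 := by
    simp only [lineSum_zchoose_add hA, h, smul_zero, finsum_zero]
  -- the weights vanish to the left of `M` and are `1` there, so only one term survives
  refine hM ?_
  rw [← hzero, lineSum, finsum_eq_single _ M fun p hp => ?_]
  · rw [neg_add_eq_sub, ← zchoose_symm (by lia), sub_self, zchoose_zero_right, one_smul]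
  · by_cases hp' : A p (d - p) = 0
    · rw [hp', smul_zero]
    · have hpM : p ≤ M := hmax p hp'
      have hpN : N ≤ p := by by_contra! h; exact hp' (hN _ _ (Or.inl h))
      rw [zchoose_eq_zero_of_lt (by lia) (by lia), zero_smul]

theorem eq_of_taylorCoeff_eq (hA : IsLaurent₂ A) (hB : IsLaurent₂ B)
    (h : ∀ j c, taylorCoeff A j c = taylorCoeff B j c) : A = B :=
  sub_eq_zero.1 <| eq_zero_of_taylorCoeff_eq_zero (hA.sub hB) fun j c => by
    rw [taylorCoeff, hA.lineSum_sub hB]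
    exact sub_eq_zero.2 (h j c)

theorem taylorCoeff_swap (hA : IsLaurent₂ A) (j c : ℤ) :
    taylorCoeff (swap A) j c =
      ∑ᶠ l : ℕ, ((-1 : ℂ) ^ (j - l) * zchoose (c + l) l) • taylorCoeff A (j - l) (c + l) := by
  have hweight : (fun m => zchoose (c + j - m) j) =
      (-1 : ℂ) ^ j • fun m => zchoose (-c - 1 + m) j := by
    ext m
    rw [zchoose_neg, Pi.smul_apply, smul_eq_mul]
    congr 2; ring
  rw [taylorCoeff, lineSum_swap, hweight, ← smul_lineSum, lineSum_zchoose_add hA, smul_finsum]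
  refine finsum_congr fun l => ?_
  rw [zchoose_neg (-c - 1), smul_smul, neg_one_zpow_sub, mul_assoc]
  congr 2 <;> [congr 2; skip] <;> ring

/-! ### Multiplication by powers of `x₁ - x₂` -/

/-- The coefficient of `x₁ ^ p * x₂ ^ q` in `(x₁ - x₂) ^ n * P(x₁, x₂)`, the power being expanded
in nonnegative powers of `x₂`. -/
def mulPow (n : ℤ) (P : ℤ → ℤ → U) (p q : ℤ) : U :=
  ∑ᶠ i : ℕ, subPowCoeff n i • P (p - n + i) (q - i)

theorem mulPow_eq_lineSum (n : ℤ) (P : ℤ → ℤ → U) (p q : ℤ) :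
    mulPow n P p q =
      lineSum P (p + q - n) fun m => (-1) ^ (m - p + n) * zchoose n (m - p + n) := by
  rw [lineSum, ← finsum_comp_of_injective
    (show Function.Injective fun i : ℕ => p - n + i from fun i j h => by simpa using h)]
  · refine finsum_congr fun i => ?_
    rw [subPowCoeff_eq, show p - n + (i : ℤ) - p + n = i by ring, zpow_natCast]
    congr 2; ring
  · intro m hm
    by_contra h
    have : m - p + n < 0 := by
      by_contra! h'
      exact h ⟨(m - p + n).toNat, by simp only; lia⟩
    exact hm (by simp only [zchoose_of_neg _ this, mul_zero, zero_smul])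

theorem mulPow_natCast (k : ℕ) (P : ℤ → ℤ → U) (p q : ℤ) :
    mulPow k P p q = ∑ i ∈ Finset.range (k + 1),
      ((-1 : ℂ) ^ i * (k.choose i : ℂ)) • P (p - (k - i)) (q - i) := by
  rw [mulPow, finsum_eq_sum_of_support_subset (s := Finset.range (k + 1))]
  · refine Finset.sum_congr rfl fun i _ => ?_
    rw [subPowCoeff_eq, zchoose_natCast_natCast]
    congr 2; ring
  · intro i hi
    by_contra h
    rw [Finset.coe_range, Set.mem_Iio, not_lt] at h
    refine hi ?_
    simp only [subPowCoeff_eq, zchoose_natCast_natCast,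
      Nat.choose_eq_zero_of_lt (show k < i by lia), Nat.cast_zero, mul_zero, zero_smul]

theorem mulPow_zero (P : ℤ → ℤ → U) : mulPow 0 P = P := by
  ext p q
  simpa using mulPow_natCast 0 P p q

theorem mulPow_smul (n : ℤ) (r : ℂ) (P : ℤ → ℤ → U) : mulPow n (r • P) = r • mulPow n P := by
  ext p q
  simp only [Pi.smul_apply, mulPow_eq_lineSum, lineSum_smul]

theorem mulPow_swap (k : ℕ) (P : ℤ → ℤ → U) :
    mulPow k (swap P) = (-1 : ℂ) ^ k • swap (mulPow k P) := by
  ext p q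
  simp only [Pi.smul_apply, swap, mulPow_eq_lineSum, smul_lineSum]
  rw [lineSum_swap, add_comm q p]
  refine lineSum_congr fun m _ => ?_
  rw [Pi.smul_apply, smul_eq_mul, ← zchoose_symm k.cast_nonneg (m - q + k), ← mul_assoc,
    ← zpow_natCast, ← neg_one_zpow_add]
  congr 1
  · exact neg_one_zpow_congr ⟨q - m - k, by ring⟩
  · congr 1; ring

theorem swap_mulPow (k : ℕ) (P : ℤ → ℤ → U) :
    swap (mulPow k P) = (-1 : ℂ) ^ k • mulPow k (swap P) := by
  rw [mulPow_swap k P, smul_smul, ← mul_pow, neg_one_mul, neg_neg, one_pow, one_smul]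

theorem mulPow_swap_eq_of_eq_mulPow_swap {k : ℕ} {P Q : ℤ → ℤ → U}
    (h : mulPow k P = mulPow k (swap Q)) : mulPow k (swap P) = mulPow k Q := by
  rw [mulPow_swap k P, h, ← mulPow_swap]

namespace IsTruncatedRight

theorem finite_support_mulPow (hP : IsTruncatedRight P) (n p q : ℤ) :
    (support fun i : ℕ => subPowCoeff n i • P (p - n + i) (q - i)).Finite := by
  obtain ⟨N, hN⟩ := hP
  refine (Set.finite_Iic (q - N).toNat).subset fun i hi => ?_
  by_contra h
  rw [Set.mem_Iic, not_le] at h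
  exact hi (by simp only [hN _ (q - i) (by lia), smul_zero])

protected theorem mulPow (hP : IsTruncatedRight P) (n : ℤ) : IsTruncatedRight (mulPow n P) := by
  obtain ⟨N, hN⟩ := hP
  refine ⟨N, fun p q hq => finsum_eq_zero_of_forall_eq_zero fun i => ?_⟩
  rw [hN _ _ (by lia), smul_zero]

protected theorem smul (hP : IsTruncatedRight P) (r : ℂ) : IsTruncatedRight (r • P) := by
  obtain ⟨N, hN⟩ := hP
  exact ⟨N, fun p q hq => by simp only [Pi.smul_apply, hN p q hq, smul_zero]⟩

end IsTruncatedRight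

theorem mulPow_sum (n : ℤ) {ι : Type*} (s : Finset ι) {P : ι → ℤ → ℤ → U}
    (hP : ∀ i, IsTruncatedRight (P i)) : mulPow n (∑ i ∈ s, P i) = ∑ i ∈ s, mulPow n (P i) := by
  ext p q
  simp only [mulPow, Finset.sum_apply, Finset.smul_sum]
  exact finsum_sum_comm s _ fun i _ => (hP i).finite_support_mulPow n p q

theorem mulPow_mulPow (hP : IsTruncatedRight P) (a b : ℤ) :
    mulPow a (mulPow b P) = mulPow (a + b) P := by
  ext p q
  set s := p - a - b
  have hterm : ∀ i : ℕ, subPowCoeff a i • mulPow b P (p - a + i) (q - i) =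
      lineSum P (s + q) fun m =>
        (-1) ^ (m - s) * (zchoose a i * zchoose b (m - s - i)) := fun i => by
    rw [mulPow_eq_lineSum, smul_lineSum, show p - a + i + (q - i) - b = s + q by lia]
    refine lineSum_congr fun m _ => ?_
    rw [Pi.smul_apply, smul_eq_mul, subPowCoeff_eq, show m - (p - a + i) + b = m - s - i by lia,
      neg_one_zpow_sub _ (i : ℤ), zpow_natCast]
    have : (-1 : ℂ) ^ i * (-1) ^ i = 1 := by rw [← mul_pow]; norm_num
    linear_combination ((-1) ^ (m - s) * (zchoose a i * zchoose b (m - s - i))) * this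
  rw [mulPow, finsum_congr hterm, finsum_lineSum, mulPow_eq_lineSum,
    show p + q - (a + b) = s + q by lia]
  · refine lineSum_congr fun m _ => ?_
    rw [← mul_finsum, finsum_zchoose_mul_zchoose, show m - p + (a + b) = m - s by lia]
  · obtain ⟨N, hN⟩ := hP
    refine (Set.finite_Icc s (s + q - N)).subset fun m ⟨hm, i, hi⟩ => ⟨?_, ?_⟩
    · by_contra! h
      exact hi (by rw [zchoose_of_neg b (by lia), mul_zero, mul_zero])
    · by_contra! h
      exact hm (hN _ _ (by lia))
  · refine fun m _ => (finite_support_mul_zchoose_sub (zchoose a ·) b (m - s)).subset fun i hi => ?_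
    exact right_ne_zero_of_mul hi

theorem mulPow_mulPow_swap (hP : IsTruncatedRight P) (k l : ℕ) :
    mulPow k (mulPow l (swap P)) = mulPow (k + l : ℕ) (swap P) := by
  rw [mulPow_swap l P, mulPow_smul, mulPow_swap k, mulPow_mulPow hP, mulPow_swap (k + l) P,
    smul_smul, ← pow_add, add_comm l, Nat.cast_add]

protected theorem IsLaurent₂.mulPow (hA : IsLaurent₂ A) (k : ℕ) : IsLaurent₂ (mulPow k A) := by
  obtain ⟨N, hN⟩ := hA
  refine ⟨N, fun p q h => ?_⟩
  rw [mulPow_natCast]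
  refine Finset.sum_eq_zero fun i hi => ?_
  rw [Finset.mem_range] at hi
  rw [hN _ _ (by lia), smul_zero]

theorem taylorCoeff_mulPow (hA : IsLaurent₂ A) (k : ℕ) (j c : ℤ) :
    taylorCoeff (mulPow k A) j c = taylorCoeff A (j - k) c := by
  have hterm : ∀ m : ℤ, zchoose m j • mulPow k A m (c + j - m) = lineSum A (c + (j - k))
      fun n => ((-1) ^ (n - m + k) * zchoose k (n - m + k)) * zchoose m j := fun m => by
    rw [mulPow_eq_lineSum, smul_lineSum, add_sub_cancel, ← add_sub_assoc]
    exact lineSum_congr fun n _ => mul_comm _ _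
  rw [taylorCoeff, lineSum, finsum_congr hterm, hA.finsum_lineSum, taylorCoeff]
  · exact lineSum_congr fun n _ => finsum_fwdDiff_zchoose k n j
  · refine fun n => (Set.finite_Icc n (n + k)).subset fun m hm => ?_
    have hm := right_ne_zero_of_mul (left_ne_zero_of_mul hm)
    constructor <;> by_contra! h
    · exact hm (zchoose_eq_zero_of_lt k.cast_nonneg (by lia))
    · exact hm (zchoose_of_neg _ (by lia))

theorem mulPow_sub_mulPow_swap (hA : IsLaurent₂ A) (N b c : ℤ) :
    mulPow N A b c - (-1 : ℂ) ^ N • mulPow N (swap A) c b =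
      lineSum A (b + c - N) fun m => zchoose (m - b - 1) (-N - 1) := by
  rw [mulPow_eq_lineSum, mulPow_eq_lineSum, lineSum_swap A, smul_lineSum, add_comm c b,
    ← hA.lineSum_weight_sub]
  refine lineSum_congr fun m _ => ?_
  rw [Pi.sub_apply, Pi.smul_apply, smul_eq_mul, ← mul_assoc, ← neg_one_zpow_add,
    neg_one_zpow_congr (m := N + _) (n := m - b + N) ⟨b - m, by ring⟩, ← mul_sub,
    show m - b - 1 = -(b - m) - 1 by ring, ← zchoose_residue]
  congr 1
  · congr 1; ring
  · congr 2 <;> ring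

theorem mulPow_sub_mulPow_of_local (hP : IsTruncatedRight P) (hQ : IsTruncatedRight Q)
    {k : ℕ} (hPQ : mulPow k P = mulPow k (swap Q)) (hL : IsLaurent₂ (mulPow k P)) (N b c : ℤ) :
    mulPow N P b c - (-1 : ℂ) ^ N • mulPow N Q c b =
      lineSum (mulPow k P) (b + c - (N - k)) fun m => zchoose (m - b - 1) (k - N - 1) := by
  have hP' : mulPow N P = mulPow (N - k) (mulPow k P) := by
    rw [mulPow_mulPow hP, sub_add_cancel]
  have hQ' : mulPow N Q = (-1 : ℂ) ^ k • mulPow (N - k) (swap (mulPow k P)) := by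
    have hswap : mulPow k Q = (-1 : ℂ) ^ k • swap (mulPow k (swap Q)) := mulPow_swap k (swap Q)
    rw [hPQ, ← mulPow_smul, ← hswap, mulPow_mulPow hQ, sub_add_cancel]
  rw [hP', hQ', Pi.smul_apply, Pi.smul_apply, smul_smul, ← zpow_natCast, ← neg_one_zpow_add,
    neg_one_zpow_congr (n := N - k) ⟨k, by ring⟩, mulPow_sub_mulPow_swap hL, neg_sub]

end TwoVariables

/-! ### Powers of the coordinate changes -/

section Coordinates

/-- The series `x ^ m * (1 + z * x ^ (-ε)) ^ (ε * m)`. For `ε = 1` and `ε = -1` this is the `m`-th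
power of `x + z` and of `x / (1 + z * x)`, respectively. -/
def coordPow (ε m : ℤ) : PowerSeries (LaurentSeries ℂ) :=
  PowerSeries.mk fun j => HahnSeries.single (m - ε * j) (zchoose (ε * m) j)

theorem coordPow_zero (ε : ℤ) : coordPow ε 0 = 1 := by
  ext1 j
  rw [coordPow, PowerSeries.coeff_mk, PowerSeries.coeff_one, mul_zero, zchoose_zero_left]
  by_cases h : j = 0 <;> simp [h]

theorem coordPow_mul (ε m n : ℤ) : coordPow ε m * coordPow ε n = coordPow ε (m + n) := by
  ext1 j
  have hterm : ∀ i ∈ Finset.range (j + 1),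
      HahnSeries.single (m - ε * i) (zchoose (ε * m) i) *
        HahnSeries.single (n - ε * (j - i : ℕ)) (zchoose (ε * n) (j - i : ℕ)) =
      HahnSeries.single.linearMap (R := ℂ) (m + n - ε * j)
        (zchoose (ε * m) i * zchoose (ε * n) (j - i)) := fun i hi => by
    rw [HahnSeries.single_mul_single, HahnSeries.single.linearMap_apply,
      Nat.cast_sub (Finset.mem_range_succ_iff.1 hi)]
    congr 2; ring
  simp only [coordPow, PowerSeries.coeff_mk, PowerSeries.coeff_mul,
    Finset.Nat.sum_antidiagonal_eq_sum_range_succ_mk]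
  rw [Finset.sum_congr rfl hterm, ← map_sum, mul_add, ← finsum_zchoose_mul_zchoose,
    finsum_eq_sum_of_support_subset _ (s := Finset.range (j + 1)) fun i hi => ?_]
  · rfl
  · by_contra h
    rw [Finset.mem_coe, Finset.mem_range] at h
    exact hi (by simp only [zchoose_of_neg _ (show (j : ℤ) - i < 0 by lia), mul_zero])

theorem coordPow_pow (ε m : ℤ) (n : ℕ) : coordPow ε m ^ n = coordPow ε (m * n) := by
  induction n with
  | zero => simp [coordPow_zero]
  | succ n ih => rw [pow_succ, ih, coordPow_mul, Nat.cast_succ, mul_add_one]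

theorem coordPow_inv (ε m : ℤ) : (coordPow ε m)⁻¹ = coordPow ε (-m) := by
  have hinv : coordPow ε (-m) * coordPow ε m = 1 := by
    rw [coordPow_mul, neg_add_cancel, coordPow_zero]
  have hconst : PowerSeries.constantCoeff (coordPow ε m) ≠ 0 := fun h => by
    simpa [h] using congrArg PowerSeries.constantCoeff hinv
  exact ((PowerSeries.eq_inv_iff_mul_eq_one hconst).2 hinv).symm

theorem phiPow_coordPow (ε m : ℤ) : phiPow (coordPow ε 1) m = coordPow ε m := by
  cases m with
  | ofNat m => rw [phiPow, coordPow_pow, one_mul, Int.ofNat_eq_natCast]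
  | negSucc m =>
    rw [phiPow, coordPow_inv, coordPow_pow, neg_one_mul, Int.negSucc_eq, Nat.cast_succ]

theorem coordPow_eq_add {ε m : ℤ} (h : ε * m = 1) :
    coordPow ε m = PowerSeries.C (HahnSeries.single m 1) +
      PowerSeries.C (HahnSeries.single (m - ε) 1) * PowerSeries.X := by
  ext1 j
  have h₁ : zchoose 1 1 = 1 := by simpa using zchoose_natCast_natCast 1 1
  have h₂ (j : ℕ) : zchoose 1 (j + 1 + 1) = 0 := zchoose_eq_zero_of_lt zero_le_one (by lia)
  rw [coordPow, PowerSeries.coeff_mk, h, map_add, PowerSeries.coeff_C_mul, PowerSeries.coeff_C,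
    PowerSeries.coeff_X]
  rcases j with _ | _ | j
  · simp
  · simp [h₁]
  · simp [h₂]

theorem coordPow_one_one : coordPow 1 1 = phiAdd := by
  simp [coordPow_eq_add (one_mul 1), phiAdd, varX, varZ]

theorem one_add_varZ_mul_varX_mul : (1 + varZ * varX) * coordPow (-1) 1 = varX := by
  have h : (1 + varZ * varX : PowerSeries (LaurentSeries ℂ)) = varX * coordPow (-1) (-1) := by
    rw [coordPow_eq_add (by norm_num), mul_add, varX, ← map_mul, HahnSeries.single_mul_single]
    simp [varZ, mul_comm]
  rw [h, mul_assoc, coordPow_mul, neg_add_cancel, coordPow_zero, mul_one]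

theorem coordPow_neg_one_one : coordPow (-1) 1 = phiStar := by
  have hconst : PowerSeries.constantCoeff (1 + varZ * varX) ≠ 0 := by simp [varZ]
  rw [phiStar, PowerSeries.eq_mul_inv_iff_mul_eq hconst, mul_comm]
  exact one_add_varZ_mul_varX_mul

theorem zxCoeff_coordPow (ε m j q : ℤ) :
    zxCoeff (coordPow ε m) j q = if q = m - ε * j then zchoose (ε * m) j else 0 := by
  rw [zxCoeff]
  split_ifs with h hq hq
  · lift j to ℕ using h
    simp [coordPow, hq]
  · lift j to ℕ using h
    simp [coordPow, hq]
  · rw [zchoose_of_neg _ (by lia)]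
  · rfl

theorem zxCoeff_X_pow_mul (F : PowerSeries (LaurentSeries ℂ)) (k : ℕ) (j q : ℤ) :
    zxCoeff (PowerSeries.X ^ k * F) j q = zxCoeff F (j - k) q := by
  rcases lt_or_ge j 0 with hj | hj
  · rw [zxCoeff, zxCoeff, if_neg (by lia), if_neg (by lia)]
  lift j to ℕ using hj
  rw [zxCoeff, zxCoeff, if_pos (by lia), PowerSeries.coeff_X_pow_mul', Int.toNat_natCast]
  by_cases h : k ≤ j
  · rw [if_pos h, if_pos (by lia), show ((j : ℤ) - k).toNat = j - k by lia]
  · rw [if_neg h, if_neg (by lia), HahnSeries.coeff_zero]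

theorem zxCoeff_C_single_mul (F : PowerSeries (LaurentSeries ℂ)) (n : ℤ) (r : ℂ) (j q : ℤ) :
    zxCoeff (PowerSeries.C (HahnSeries.single n r) * F) j q = r * zxCoeff F j (q - n) := by
  rw [zxCoeff, zxCoeff, PowerSeries.coeff_C_mul, mul_ite, mul_zero]
  congr 1
  conv_lhs => rw [← sub_add_cancel q n, HahnSeries.coeff_single_mul_add]

theorem zxCoeff_phiAdd_sub_varX_pow (k : ℕ) (j q : ℤ) :
    zxCoeff ((phiAdd - varX) ^ k) j q = if (j, q) = ((k : ℤ), 0) then 1 else 0 := by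
  rw [phiAdd, add_sub_cancel_left, varZ, ← mul_one (PowerSeries.X ^ k), ← coordPow_zero 1,
    zxCoeff_X_pow_mul, zxCoeff_coordPow, mul_zero, zchoose_zero_left]
  simp only [Prod.mk.injEq]
  split_ifs <;> first | rfl | lia

theorem zxCoeff_phiStar_sub_varX_pow (k : ℕ) (j q : ℤ) :
    zxCoeff ((phiStar - varX) ^ k) j q =
      if q = k + j then (-1) ^ k * zchoose (-k) (j - k) else 0 := by
  have hsub : phiStar - varX =
      PowerSeries.C (HahnSeries.single 1 (-1)) * (PowerSeries.X * coordPow (-1) 1) := by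
    have := one_add_varZ_mul_varX_mul
    rw [HahnSeries.single_neg, map_neg, ← varX, ← coordPow_neg_one_one]
    rw [varZ] at this
    linear_combination this
  rw [hsub, mul_pow, mul_pow, ← map_pow, HahnSeries.single_pow, coordPow_pow, nsmul_one, one_mul,
    zxCoeff_C_single_mul, zxCoeff_X_pow_mul, zxCoeff_coordPow, mul_ite, mul_zero, neg_one_mul,
    neg_one_mul]
  congr 1
  exact propext ⟨fun h => by lia, fun h => by lia⟩

variable {V : Type*} [AddCommGroup V] [Module ℂ V] {W : Type*} [AddCommGroup W] [Module ℂ W]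

theorem substCoeff_coordPow (ε : ℤ) (A : ℤ → ℤ → W) (j c : ℤ) :
    substCoeff (coordPow ε 1) A j c = lineSum A (c + ε * j) fun m => zchoose (ε * m) j := by
  rw [substCoeff, lineSum, ← finsum_comp_of_injective
    (e := fun m : ℤ => (m, c + ε * j - m)) fun m n h => (Prod.ext_iff.1 h).1]
  · refine finsum_congr fun m => ?_
    rw [phiPow_coordPow, zxCoeff_coordPow, if_pos (by ring)]
  · rintro ⟨m, n⟩ h
    have h := left_ne_zero_of_smul h
    rw [phiPow_coordPow, zxCoeff_coordPow] at h
    exact ⟨m, Prod.ext rfl (by have := (ite_ne_right_iff.1 h).1; simp only at this ⊢; lia)⟩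

theorem substCoeff_phiAdd (A : ℤ → ℤ → W) (j c : ℤ) :
    substCoeff phiAdd A j c = taylorCoeff A j c := by
  simp only [← coordPow_one_one, substCoeff_coordPow, one_mul, taylorCoeff]

theorem iterateCoeff_phiAdd (Y : V →ₗ[ℂ] (ℤ → Module.End ℂ V)) (YW : V →ₗ[ℂ] (ℤ → Module.End ℂ W))
    (k : ℕ) (u v : V) (w : W) (j c : ℤ) :
    iterateCoeff Y YW ((phiAdd - varX) ^ k) u v w j c = YW (Y u (j - k) v) c w := by
  rw [iterateCoeff, finsum_eq_single _ ((k : ℤ), (0 : ℤ)) fun p hp => by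
    rw [zxCoeff_phiAdd_sub_varX_pow, if_neg hp, zero_smul]]
  rw [zxCoeff_phiAdd_sub_varX_pow, if_pos rfl, one_smul, sub_zero]

theorem iterateCoeff_phiStar (Y : V →ₗ[ℂ] (ℤ → Module.End ℂ V))
    (YW : V →ₗ[ℂ] (ℤ → Module.End ℂ W)) (k : ℕ) (u v : V) (w : W) (j c : ℤ) :
    iterateCoeff Y YW ((phiStar - varX) ^ k) u v w j c =
      ∑ᶠ i : ℕ, ((-1) ^ k * zchoose (-k) i) • YW (Y u (j - k - i) v) (c - 2 * k - i) w := by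
  rw [iterateCoeff, ← finsum_comp_of_injective
    (show Function.Injective fun i : ℕ => ((k + i : ℤ), (2 * k + i : ℤ)) from
      fun m n h => by simpa using (Prod.ext_iff.1 h).1)]
  · refine finsum_congr fun i => ?_
    rw [zxCoeff_phiStar_sub_varX_pow, if_pos (by ring), add_sub_cancel_left, sub_sub, sub_sub]
  · rintro ⟨m, n⟩ h
    have h := left_ne_zero_of_smul h
    rw [zxCoeff_phiStar_sub_varX_pow, ite_ne_right_iff] at h
    have hm : 0 ≤ m - k := by
      by_contra! hm
      exact h.2 (by rw [zchoose_of_neg _ hm, mul_zero])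
    exact ⟨(m - k).toNat, Prod.ext (by simp only; lia) (by have := h.1; simp only at this ⊢; lia)⟩

end Coordinates

/-! ### Operator product expansions -/

section OPE

variable {U : Type*} [AddCommGroup U] [Module ℂ U] {P Q B : ℤ → ℤ → U} {k : ℕ}

/-- `(x₁ - x₂) ^ k P(x₁, x₂)` lies in `U((x₁, x₂))` and becomes `z ^ k B(z, x₂)` at `x₁ = x₂ + z`.
Here `B j c` is the coefficient of `z ^ j * x₂ ^ c`. -/
def HasOPE (P : ℤ → ℤ → U) (k : ℕ) (B : ℤ → ℤ → U) : Prop :=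
  IsLaurent₂ (mulPow k P) ∧ ∀ j c, taylorCoeff (mulPow k P) j c = B (j - k) c

namespace HasOPE

theorem mono (h : HasOPE P k B) (hP : IsTruncatedRight P) {k' : ℕ} (hk : k ≤ k') :
    HasOPE P k' B := by
  obtain ⟨l, rfl⟩ := Nat.exists_eq_add_of_le' hk
  have hmul : mulPow (l + k : ℕ) P = mulPow l (mulPow k P) := by
    rw [mulPow_mulPow hP, Nat.cast_add]
  rw [HasOPE, hmul]
  refine ⟨h.1.mulPow l, fun j c => ?_⟩
  rw [taylorCoeff_mulPow h.1, h.2, Nat.cast_add, sub_sub]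

protected theorem sum {ι : Type*} (s : Finset ι) {P B : ι → ℤ → ℤ → U}
    (hP : ∀ i, IsTruncatedRight (P i)) (h : ∀ i, HasOPE (P i) k (B i)) :
    HasOPE (∑ i ∈ s, P i) k (∑ i ∈ s, B i) := by
  rw [HasOPE, mulPow_sum _ _ hP]
  refine ⟨.sum s fun i => (h i).1, fun j c => ?_⟩
  rw [taylorCoeff_sum s fun i => (h i).1]
  simp only [(h _).2, Finset.sum_apply]

protected theorem swap (h : HasOPE P k B) : HasOPE (swap P) k fun j c =>
    ∑ᶠ l : ℕ, ((-1 : ℂ) ^ (j - l) * zchoose (c + l) l) • B (j - l) (c + l) := by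
  rw [HasOPE, mulPow_swap]
  refine ⟨h.1.swap.smul _, fun j c => ?_⟩
  rw [taylorCoeff_smul, taylorCoeff_swap h.1, smul_finsum]
  refine finsum_congr fun l => ?_
  rw [h.2, smul_smul, ← mul_assoc, ← zpow_natCast, ← neg_one_zpow_add,
    neg_one_zpow_congr (n := j - k - l) ⟨k, by ring⟩, sub_right_comm j l]

protected theorem congr (h : HasOPE P k B) (hPQ : mulPow k P = mulPow k Q) : HasOPE Q k B := by
  rwa [HasOPE, ← hPQ]

theorem mulPow_eq (hP : HasOPE P k B) (hQ : HasOPE Q k B) : mulPow k P = mulPow k Q :=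
  eq_of_taylorCoeff_eq hP.1 hQ.1 fun j c => (hP.2 j c).trans (hQ.2 j c).symm

theorem eq (h : HasOPE P k B) {B' : ℤ → ℤ → U} (h' : HasOPE P k B') : B = B' := by
  ext j c
  rw [← add_sub_cancel_right j (k : ℤ), ← h.2, h'.2]

theorem taylorCoeff_eq (h : HasOPE P k B) (hP : IsLaurent₂ P) : taylorCoeff P = B := by
  ext j c
  rw [← add_sub_cancel_right j (k : ℤ), ← h.2, taylorCoeff_mulPow hP]

theorem eq_of_const_left {f : ℤ → U} (hf : IsLaurent f) (h : HasOPE (Pi.single 0 f) k B) :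
    B = Pi.single 0 f := by
  rw [← h.taylorCoeff_eq hf.single]
  ext j c
  rw [taylorCoeff, lineSum_single, zchoose_zero_left, sub_zero]
  rcases eq_or_ne j 0 with rfl | hj
  · rw [if_pos rfl, one_smul, add_zero, Pi.single_eq_same]
  · rw [if_neg hj, zero_smul, Pi.single_eq_of_ne hj, Pi.zero_apply]

theorem eq_of_const_right {f : ℤ → U} (hf : IsLaurent f)
    (h : HasOPE (swap (Pi.single 0 f)) k B) (j c : ℤ) : B j c = zchoose (c + j) j • f (c + j) := by
  rw [← h.taylorCoeff_eq hf.single.swap, taylorCoeff, lineSum_swap, lineSum_single, sub_zero]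

theorem mulPow_sub_mulPow (h : HasOPE P k B) (hP : IsTruncatedRight P) (hQ : IsTruncatedRight Q)
    (hPQ : mulPow k P = mulPow k (swap Q)) (N b c : ℤ) :
    mulPow N P b c - (-1 : ℂ) ^ N • mulPow N Q c b =
      ∑ᶠ i : ℕ, zchoose (-b - 1) i • B (-N - 1 - i) (b + c + 1 + i) := by
  rw [mulPow_sub_mulPow_of_local hP hQ hPQ h.1]
  have hweight : ∀ m, m - b - 1 = -b - 1 + m := fun m => by ring
  simp only [hweight, lineSum_zchoose_add h.1, h.2]
  refine finsum_congr fun i => ?_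
  congr 2 <;> ring

end HasOPE

theorem hasOPE_of_local (hP : IsTruncatedRight P) (hQ : IsTruncatedRight Q)
    (hPQ : mulPow k P = mulPow k (swap Q)) : HasOPE P k fun j c =>
      mulPow (-j - 1) P (-1) c - (-1 : ℂ) ^ (-j - 1) • mulPow (-j - 1) Q c (-1) := by
  have hswap : swap (mulPow k P) = (-1 : ℂ) ^ k • mulPow k Q :=
    hPQ ▸ swap_mulPow k (swap Q)
  have hL : IsLaurent₂ (mulPow k P) := by
    refine (hP.mulPow k).isLaurent₂ ?_
    rw [hswap, ← mulPow_smul]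
    exact (hQ.smul _).mulPow k
  refine ⟨hL, fun j c => ?_⟩
  simp only [mulPow_sub_mulPow_of_local hP hQ hPQ hL, taylorCoeff]
  congr 1
  · ring
  · ext m
    congr 1 <;> ring

end OPE

/-! ### Associativity -/

section Assoc

variable {V : Type*} [AddCommGroup V] [Module ℂ V] {W : Type*} [AddCommGroup W] [Module ℂ W]
  {Y : V →ₗ[ℂ] (ℤ → Module.End ℂ V)} {YW : V →ₗ[ℂ] (ℤ → Module.End ℂ W)} {one : V}

/-- The coefficient of `x₁ ^ p * x₂ ^ q` in `Y_W(u, x₁) Y_W(v, x₂) w`. -/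
def prodCoeff (YW : V →ₗ[ℂ] (ℤ → Module.End ℂ W)) (u v : V) (w : W) (p q : ℤ) : W :=
  YW u p (YW v q w)

theorem mulPowCoeff_eq (k : ℕ) (u v : V) (w : W) :
    mulPowCoeff YW k u v w = mulPow k (prodCoeff YW u v w) := by
  ext m n
  rw [mulPow_natCast]
  rfl

theorem isTruncatedRight_prodCoeff {v : V} {w : W} (h : IsLaurent fun n => YW v n w) (u : V) :
    IsTruncatedRight (prodCoeff YW u v w) := by
  obtain ⟨N, hN⟩ := h
  exact ⟨N, fun p q hq => (congrArg (YW u p) (hN q hq)).trans (map_zero _)⟩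

theorem prodCoeff_one_left (hone : YW one = Pi.single 0 1) (v : V) (w : W) :
    prodCoeff YW one v w = Pi.single 0 fun n => YW v n w := by
  ext p q
  rw [prodCoeff, hone]
  rcases eq_or_ne p 0 with rfl | hp
  · rw [Pi.single_eq_same, Pi.single_eq_same, Module.End.one_apply]
  · rw [Pi.single_eq_of_ne hp, Pi.single_eq_of_ne hp, LinearMap.zero_apply, Pi.zero_apply]

theorem prodCoeff_one_right (hone : YW one = Pi.single 0 1) (u : V) (w : W) :
    prodCoeff YW u one w = swap (Pi.single 0 fun m => YW u m w) := by
  ext p q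
  rw [prodCoeff, hone, swap]
  rcases eq_or_ne q 0 with rfl | hq
  · rw [Pi.single_eq_same, Pi.single_eq_same, Module.End.one_apply]
  · rw [Pi.single_eq_of_ne hq, Pi.single_eq_of_ne hq, LinearMap.zero_apply, map_zero,
      Pi.zero_apply]

/-- Weak associativity with exponent `k`:
`((x₁ - x₂) ^ k Y_W(u, x₁) Y_W(v, x₂))|_{x₁ = x₂ + z} = z ^ k Y_W(Y(u, z) v, x₂)`. -/
def IsAssocAt (Y : V →ₗ[ℂ] (ℤ → Module.End ℂ V)) (YW : V →ₗ[ℂ] (ℤ → Module.End ℂ W)) (u v : V)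
    (k : ℕ) : Prop :=
  ∀ w, HasOPE (prodCoeff YW u v w) k fun j c => YW (Y u j v) c w

theorem isModule_iff : IsModule Y one YW ↔ (∀ v w, IsLaurent fun n => YW v n w) ∧
    YW one = Pi.single 0 1 ∧ ∀ u v, ∃ k, IsAssocAt Y YW u v k := by
  have hassoc : ∀ u v : V, (∃ k, IsAssocAt Y YW u v k) ↔ ∃ k : ℕ,
      (∀ w, IsLaurent₂ (mulPowCoeff YW k u v w)) ∧ ∀ w j c,
        substCoeff phiAdd (mulPowCoeff YW k u v w) j c =
          iterateCoeff Y YW ((phiAdd - varX) ^ k) u v w j c := fun u v => by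
    simp only [mulPowCoeff_eq, substCoeff_phiAdd, iterateCoeff_phiAdd, ← forall_and]
    rfl
  simp only [hassoc]
  exact ⟨fun h => ⟨h.truncation, h.vacuum, h.assoc⟩, fun h => ⟨h.1, h.2.1, h.2.2⟩⟩

theorem IsModule.exists_isAssocAt (hW : IsModule Y one YW) (u v : V) :
    ∃ k, IsAssocAt Y YW u v k :=
  (isModule_iff.1 hW).2.2 u v

theorem IsModule.eventually_isAssocAt (hW : IsModule Y one YW) (u v : V) :
    ∀ᶠ k in Filter.atTop, IsAssocAt Y YW u v k := by
  obtain ⟨k, hk⟩ := hW.exists_isAssocAt u v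
  filter_upwards [Filter.eventually_ge_atTop k] with l hl w
  exact (hk w).mono (isTruncatedRight_prodCoeff (hW.truncation v w) u) hl

/-- `Y_W(e ^ (z 𝒟) a, x) = Y_W(a, x + z)`, the series `e ^ (z 𝒟) a` being `Y(a, z) 𝟏`. -/
def IsTranslationCovariant (Y : V →ₗ[ℂ] (ℤ → Module.End ℂ V)) (one : V)
    (YW : V →ₗ[ℂ] (ℤ → Module.End ℂ W)) : Prop :=
  ∀ (a : V) (l : ℕ) (c : ℤ) (w : W),
    YW (Y a l one) c w = zchoose (c + l) l • YW a (c + l) w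

theorem IsModule.isTranslationCovariant (hW : IsModule Y one YW) :
    IsTranslationCovariant Y one YW := fun a l c w => by
  obtain ⟨k, hk⟩ := hW.exists_isAssocAt a one
  have hOPE : HasOPE _ k _ := prodCoeff_one_right hW.vacuum a w ▸ hk w
  exact hOPE.eq_of_const_right (hW.truncation a w) l c

/-- A vertex algebra without the commutativity axiom: the Jacobi identity is replaced by weak
associativity. -/
structure IsNonlocalVertexAlgebra (Y : V →ₗ[ℂ] (ℤ → Module.End ℂ V)) (one : V) : Prop where
  truncation : ∀ u v : V, IsLaurent fun n => Y u n v
  vacuum : Y one = Pi.single 0 1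
  creation : ∀ u : V, ∀ n < 0, Y u n one = 0
  creation_limit : ∀ u : V, Y u 0 one = u
  assoc : ∀ u v : V, ∃ k, IsAssocAt Y Y u v k

theorem IsNonlocalVertexAlgebra.isModule (hV : IsNonlocalVertexAlgebra Y one) :
    IsModule Y one Y :=
  isModule_iff.2 ⟨hV.truncation, hV.vacuum, hV.assoc⟩

end Assoc

/-! ### The opposite algebra -/

section Reflection

variable {U : Type*} [AddCommGroup U] [Module ℂ U] {A Q B : ℤ → ℤ → U} {k l : ℕ}

/-- The coefficients of `z ^ (-k) A(z - x, -x)`, expanded in nonnegative powers of `z`. The first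
argument is the exponent of `z`. -/
def reflectCoeff (A : ℤ → ℤ → U) (k : ℕ) (n m : ℤ) : U := (-1 : ℂ) ^ m • taylorCoeff A (n + k) m

theorem mulPow_reflectCoeff (hA : IsLaurent₂ A) (k l : ℕ) (n m : ℤ) :
    mulPow l (reflectCoeff A k) n m = (-1 : ℂ) ^ m •
      lineSum A (m + n + k - l) fun p => zchoose (p + l) (n + k) := by
  have hterm : ∀ i : ℕ, subPowCoeff l i • reflectCoeff A k (n - l + i) (m - i) =
      (-1 : ℂ) ^ m • lineSum A (m + n + k - l)
        fun p => zchoose l i * zchoose p (n + k - l + i) := fun i => by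
    rw [reflectCoeff, taylorCoeff, smul_smul, subPowCoeff_eq, neg_one_zpow_sub, zpow_natCast,
      show m - i + (n - l + i + k) = m + n + k - l by ring,
      show n - l + i + k = n + k - l + i by ring, mul_right_comm, mul_left_comm, ← mul_pow,
      neg_one_mul, neg_neg, one_pow, mul_one, ← smul_smul, smul_lineSum]
    rfl
  rw [mulPow, finsum_congr hterm, ← smul_finsum, hA.finsum_lineSum]
  · simp only [finsum_zchoose_mul_zchoose_add, sub_add_cancel]
  · refine fun p => (Set.finite_Iic l).subset fun i hi => ?_
    by_contra h
    rw [Set.mem_Iic, not_le] at h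
    exact hi (by simp only [zchoose_eq_zero_of_lt l.cast_nonneg (show (l : ℤ) < i by lia),
      zero_mul])

theorem isLaurent₂_mulPow_reflectCoeff (hA : IsLaurent₂ A) (hl : ∀ p < -(l : ℤ), A p = 0) :
    IsLaurent₂ (mulPow l (reflectCoeff A k)) := by
  obtain ⟨N, hN⟩ := id hA
  refine ⟨min N (-k), fun n m h => ?_⟩
  rw [lt_min_iff, lt_min_iff] at h
  rw [mulPow_reflectCoeff hA]
  refine smul_eq_zero_of_right _ (finsum_eq_zero_of_forall_eq_zero fun p => ?_)
  beta_reduce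
  rcases lt_or_ge p (-l) with hp | hp
  · rw [hl p hp, Pi.zero_apply, smul_zero]
  rcases lt_or_ge (n + k) 0 with hn | hn
  · rw [zchoose_of_neg _ hn, zero_smul]
  rcases lt_or_ge (p + l) (n + k) with hpn | hpn
  · rw [zchoose_eq_zero_of_lt (by lia) hpn, zero_smul]
  · rw [hN _ _ (by lia), smul_zero]

theorem finsum_zchoose_mul_neg_one_zpow_mul_zchoose (q k : ℕ) (e j : ℤ) :
    ∑ᶠ n : ℤ, zchoose n j * ((-1) ^ (e - n) * zchoose q (n + k)) =
      (-1) ^ (e + k + q) * zchoose (-k) (j - q) := by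
  rw [← finsum_fwdDiff_zchoose, mul_finsum]
  refine finsum_congr fun n => ?_
  have hsign : (-1 : ℂ) ^ (e - n) = (-1) ^ (e + k + q) * (-1) ^ (q - (n + k)) := by
    rw [← neg_one_zpow_add]
    exact neg_one_zpow_congr ⟨-q, by ring⟩
  rw [show -(k : ℤ) - n + q = q - (n + k) by ring, zchoose_symm q.cast_nonneg, hsign]
  ring

theorem taylorCoeff_mulPow_reflectCoeff (hA : IsLaurent₂ A) (hl : ∀ p < -(l : ℤ), A p = 0)
    (j c : ℤ) :
    taylorCoeff (mulPow l (reflectCoeff A k)) j c =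
      (-1 : ℂ) ^ (c + k) • mulPow (-k) (swap A) c (j - l) := by
  have hterm : ∀ n : ℤ, zchoose n j • mulPow l (reflectCoeff A k) n (c + j - n) =
      lineSum A (c + j + k - l)
        fun p => zchoose n j * ((-1) ^ (c + j - n) * zchoose (p + l) (n + k)) := fun n => by
    rw [mulPow_reflectCoeff hA, smul_smul, smul_lineSum, sub_add_cancel]
    exact lineSum_congr fun p _ => mul_assoc _ _ _
  have hq : ∀ p, A p (c + j + k - l - p) ≠ 0 → ∃ q : ℕ, p + l = q := fun p hp =>
    Int.eq_ofNat_of_zero_le (by by_contra! h; exact hp (by rw [hl p (by lia), Pi.zero_apply]))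
  rw [taylorCoeff, lineSum, finsum_congr hterm, WQVA.finsum_lineSum
    ((hA.finite_line _).subset fun _ hm => hm.1), mulPow_eq_lineSum, lineSum_swap A, smul_lineSum,
    show c + (j - l) - -k = c + j + k - l by ring]
  · refine lineSum_congr fun p hp => ?_
    obtain ⟨q, hq⟩ := hq p hp
    rw [hq, finsum_zchoose_mul_neg_one_zpow_mul_zchoose, Pi.smul_apply, smul_eq_mul, ← mul_assoc,
      ← neg_one_zpow_add, show c + j + k - l - p - c + -k = j - q by lia]
    congr 1
    exact neg_one_zpow_congr ⟨q, by ring⟩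
  · intro p hp
    obtain ⟨q, hq⟩ := hq p hp
    refine (Set.finite_Icc (-k : ℤ) (q - k)).subset fun n hn => ?_
    have hn := right_ne_zero_of_mul (right_ne_zero_of_mul hn)
    constructor <;> by_contra! h
    · exact hn (zchoose_of_neg _ (by lia))
    · exact hn (zchoose_eq_zero_of_lt (by lia) (by lia))

/-- At `x₁ = x₂ + z`, the series `P(x₁, x₂) = Q(x₂, x₁)` becomes `B(z, x₂)`, hence
`B(x₁, -x₂)` becomes `P(z, -x₂)`. -/
theorem HasOPE.reflect (h : HasOPE (swap Q) k B) (hl : ∀ p, ∀ q < -(l : ℤ), Q p q = 0) :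
    HasOPE (fun n m => (-1 : ℂ) ^ m • B n m) l fun j c => (-1 : ℂ) ^ c • Q c j := by
  have hQ : IsTruncatedRight Q := ⟨_, hl⟩
  have hAl : ∀ p < -(l : ℤ), mulPow k (swap Q) p = 0 := fun p hp => by
    ext q
    rw [mulPow_swap, Pi.smul_apply, Pi.smul_apply, swap, mulPow]
    refine smul_eq_zero_of_right _ (finsum_eq_zero_of_forall_eq_zero fun i => ?_)
    rw [hl _ _ (by lia), smul_zero]
  have hB : (fun n m => (-1 : ℂ) ^ m • B n m) = reflectCoeff (mulPow k (swap Q)) k := by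
    ext n m
    rw [reflectCoeff, h.2, add_sub_cancel_right]
  rw [hB]
  refine ⟨isLaurent₂_mulPow_reflectCoeff h.1 hAl, fun j c => ?_⟩
  have hswap : swap (mulPow k (swap Q)) = (-1 : ℂ) ^ k • mulPow k Q := by
    rw [mulPow_swap]
    rfl
  rw [taylorCoeff_mulPow_reflectCoeff h.1 hAl, hswap, mulPow_smul, mulPow_mulPow hQ, neg_add_cancel,
    mulPow_zero, Pi.smul_apply, Pi.smul_apply, smul_smul, ← zpow_natCast, ← neg_one_zpow_add,
    neg_one_zpow_congr ⟨k, by ring⟩]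

end Reflection

section OperatorSeries

theorem IsLaurent.finite_support_sub {M : Type*} [Zero M] {f : ℤ → M} (hf : IsLaurent f)
    (n : ℤ) : (support fun s : ℕ => f (n - s)).Finite := by
  obtain ⟨N, hN⟩ := hf
  refine (Set.finite_Iic (n - N).toNat).subset fun s hs => ?_
  by_contra h
  rw [Set.mem_Iic, not_le] at h
  exact hs (hN _ (by lia))

variable {U : Type*} [AddCommGroup U] [Module ℂ U] {U' : Type*} [AddCommGroup U'] [Module ℂ U']
  {A R C : ℤ → ℤ → U} {k : ℕ}

/-- The product of the operator-valued power series `∑ₛ T s * x₂ ^ s` and `A(x₁, x₂)`. -/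
def operatorSeriesMul (T : ℕ → U →ₗ[ℂ] U') (A : ℤ → ℤ → U) (p q : ℤ) : U' :=
  ∑ᶠ s : ℕ, T s (A p (q - s))

theorem lineSum_operatorSeriesMul (T : ℕ → U →ₗ[ℂ] U') (hA : ∀ p, IsLaurent (A p)) {d : ℤ}
    {f : ℤ → ℂ} (hf : {m | f m ≠ 0 ∧ ∃ s : ℕ, A m (d - s - m) ≠ 0}.Finite) :
    lineSum (operatorSeriesMul T A) d f = ∑ᶠ s : ℕ, T s (lineSum A (d - s) f) := by
  have hcurry : ∀ m, (support fun s : ℕ => f m • T s (A m (d - s - m))).Finite := fun m =>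
    ((hA m).finite_support_sub (d - m)).subset fun s hs h => hs <| by
      simp only [sub_right_comm d, h, map_zero, smul_zero]
  have hleft : ∀ m, f m • operatorSeriesMul T A m (d - m) =
      ∑ᶠ s : ℕ, f m • T s (A m (d - s - m)) := fun m => by
    simp only [operatorSeriesMul, smul_finsum, sub_right_comm]
  have hright : ∀ s : ℕ, T s (lineSum A (d - s) f) =
      ∑ m ∈ hf.toFinset, f m • T s (A m (d - s - m)) := fun s => by
    rw [lineSum, finsum_eq_sum_of_support_subset (s := hf.toFinset), map_sum]
    · simp only [map_smul]
    · intro m hm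
      have hm := smul_ne_zero_iff.1 hm
      exact (Set.Finite.mem_toFinset hf).2 ⟨hm.1, s, hm.2⟩
  rw [finsum_congr hright, finsum_sum_comm _ _ fun m _ => hcurry m, lineSum, finsum_congr hleft]
  refine finsum_eq_sum_of_support_subset _ fun m hm => ?_
  obtain ⟨s, hs⟩ : ∃ s : ℕ, f m • T s (A m (d - s - m)) ≠ 0 := by
    by_contra! h
    exact hm (finsum_eq_zero_of_forall_eq_zero h)
  have hs := smul_ne_zero_iff.1 hs
  exact (Set.Finite.mem_toFinset hf).2 ⟨hs.1, s, fun h => hs.2 (by rw [h, map_zero])⟩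

theorem mulPow_operatorSeriesMul (T : ℕ → U →ₗ[ℂ] U') (hA : ∀ p, IsLaurent (A p)) (k : ℕ) :
    mulPow k (operatorSeriesMul T A) = operatorSeriesMul T (mulPow k A) := by
  ext p q
  rw [mulPow_eq_lineSum, lineSum_operatorSeriesMul T hA, operatorSeriesMul]
  · refine finsum_congr fun s => ?_
    rw [mulPow_eq_lineSum]
    congr 2
    ring
  · refine (Set.finite_Icc (p - k) p).subset fun m hm => ?_
    have hm := right_ne_zero_of_mul hm.1
    constructor <;> by_contra! h
    · exact hm (zchoose_of_neg _ (by lia))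
    · exact hm (zchoose_eq_zero_of_lt k.cast_nonneg (by lia))

theorem IsLaurent₂.operatorSeriesMul (hA : IsLaurent₂ A) (T : ℕ → U →ₗ[ℂ] U') :
    IsLaurent₂ (operatorSeriesMul T A) := by
  obtain ⟨N, hN⟩ := hA
  refine ⟨N, fun m n h => finsum_eq_zero_of_forall_eq_zero fun s => ?_⟩
  rw [hN _ _ (by lia), map_zero]

theorem taylorCoeff_operatorSeriesMul (T : ℕ → U →ₗ[ℂ] U') (hA : IsLaurent₂ A) (j c : ℤ) :
    taylorCoeff (operatorSeriesMul T A) j c = operatorSeriesMul T (taylorCoeff A) j c := by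
  obtain ⟨N, hN⟩ := hA
  rw [taylorCoeff, lineSum_operatorSeriesMul T fun p => ⟨N, fun q hq => hN p q (Or.inr hq)⟩]
  · simp only [operatorSeriesMul, taylorCoeff, sub_add_eq_add_sub]
  · refine (Set.finite_Icc N (c + j - N)).subset fun m hm => ?_
    obtain ⟨-, s, hs⟩ := hm
    by_contra h
    rw [Set.mem_Icc, not_and_or] at h
    exact hs (hN _ _ (by lia))

theorem HasOPE.operatorSeriesMul (h : HasOPE R k C) (hR : ∀ p, IsLaurent (R p))
    (T : ℕ → U →ₗ[ℂ] U') : HasOPE (operatorSeriesMul T R) k (operatorSeriesMul T C) := by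
  rw [HasOPE, mulPow_operatorSeriesMul T hR]
  refine ⟨h.1.operatorSeriesMul T, fun j c => ?_⟩
  simp only [taylorCoeff_operatorSeriesMul T h.1, WQVA.operatorSeriesMul, h.2]

end OperatorSeries

section Opposite

variable {V : Type*} [AddCommGroup V] [Module ℂ V] {W : Type*} [AddCommGroup W] [Module ℂ W]
  {Y : V →ₗ[ℂ] (ℤ → Module.End ℂ V)} {YW : V →ₗ[ℂ] (ℤ → Module.End ℂ W)} {one : V}
  (hV : IsNonlocalVertexAlgebra Y one)

local notation "Yᵒ" => oppositeY Y one (IsNonlocalVertexAlgebra.truncation hV)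

include hV in
theorem derivOp_pow_apply (i : ℕ) (a : V) :
    (derivOp Y one ^ i) a = (i.factorial : ℂ) • Y a i one := by
  induction i with
  | zero => rw [pow_zero, Module.End.one_apply, Nat.factorial_zero, Nat.cast_one, one_smul,
      Nat.cast_zero, hV.creation_limit]
  | succ i ih =>
    have hD : derivOp Y one (Y a i one) = ((i + 1 : ℕ) : ℂ) • Y a (i + 1 : ℕ) one := by
      change Y (Y a i one) 1 one = _
      rw [hV.isModule.isTranslationCovariant, ← Nat.cast_one, ← Nat.cast_add,
        zchoose_natCast_natCast, add_comm, Nat.choose_succ_self_right]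
    rw [pow_succ', Module.End.mul_apply, ih, map_smul, hD, smul_smul, Nat.factorial_succ, mul_comm,
      Nat.cast_mul]

theorem oppositeY_apply (u v : V) (n : ℤ) :
    Yᵒ u n v = ∑ᶠ i : ℕ, (-1 : ℂ) ^ (n - i) • Y (Y v (n - i) u) i one := by
  refine finsum_congr fun i => ?_
  rw [oppositeTerm, derivOp_pow_apply hV, smul_smul, mul_right_comm,
    inv_mul_cancel₀ (Nat.cast_ne_zero.2 i.factorial_ne_zero), one_mul]

/-- `Y_W(Yᵒ(v, z) u, x) = Y_W(Y(u, -z) v, x + z)`. -/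
theorem apply_oppositeY (hD : IsTranslationCovariant Y one YW) (u v : V) (j c : ℤ) (w : W) :
    YW (Yᵒ v j u) c w =
      ∑ᶠ l : ℕ, ((-1 : ℂ) ^ (j - l) * zchoose (c + l) l) • YW (Y u (j - l) v) (c + l) w := by
  let T : V →ₗ[ℂ] W := (LinearMap.proj c ∘ₗ YW).flip w
  have hT : ∀ a, T a = YW a c w := fun _ => rfl
  rw [oppositeY_apply hV, ← hT, map_finsum T]
  · refine finsum_congr fun l => ?_
    rw [map_smul, hT, hD, smul_smul]
  · refine ((hV.truncation u v).finite_support_sub j).subset fun l hl h => hl ?_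
    simp only [h, map_zero, Pi.zero_apply, LinearMap.zero_apply, smul_zero]

theorem IsAssocAt.hasOPE_swap {u v : V} {k : ℕ} (h : IsAssocAt Y YW u v k)
    (hD : IsTranslationCovariant Y one YW) (w : W) :
    HasOPE (swap (prodCoeff YW u v w)) k fun j c => YW (Yᵒ v j u) c w := by
  simpa only [apply_oppositeY hV hD] using (h w).swap

theorem truncation_oppositeY (u v : V) : IsLaurent fun n => Yᵒ u n v := by
  obtain ⟨N, hN⟩ := hV.truncation v u
  refine ⟨N, fun n hn => (oppositeY_apply hV u v n).trans ?_⟩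
  refine finsum_eq_zero_of_forall_eq_zero fun i => ?_
  have hzero : Y v (n - i) u = 0 := hN _ (by lia)
  rw [hzero, map_zero, Pi.zero_apply, LinearMap.zero_apply, smul_zero]

theorem oppositeY_one : Yᵒ one = Pi.single 0 1 := by
  ext n v
  obtain ⟨k, hk⟩ := hV.assoc v one
  have hOPE := hk.hasOPE_swap hV hV.isModule.isTranslationCovariant one
  rw [prodCoeff_one_right hV.vacuum] at hOPE
  have h := congrFun₂ (hOPE.eq_of_const_left (hV.truncation v one)) n 0
  rw [hV.creation_limit] at h
  rw [h]
  rcases eq_or_ne n 0 with rfl | hn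
  · rw [Pi.single_eq_same, Pi.single_eq_same, hV.creation_limit, Module.End.one_apply]
  · rw [Pi.single_eq_of_ne hn, Pi.single_eq_of_ne hn, Pi.zero_apply, LinearMap.zero_apply]

theorem oppositeY_apply_one (u : V) (n : ℤ) : Yᵒ u n one = Y u n one := by
  obtain ⟨k, hk⟩ := hV.assoc one u
  have hOPE := hk.hasOPE_swap hV hV.isModule.isTranslationCovariant one
  rw [prodCoeff_one_left hV.vacuum] at hOPE
  have h := hOPE.eq_of_const_right (hV.truncation u one) n 0
  rw [hV.creation_limit, zero_add] at h
  rw [h]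
  rcases lt_or_ge n 0 with hn | hn
  · rw [hV.creation u n hn, smul_zero]
  · rw [← zchoose_symm hn, sub_self, zchoose_zero_right, one_smul]

theorem exists_hasOPE_swap_oppositeY (u v : V) :
    ∃ l, ∀ w, HasOPE (swap (prodCoeff Yᵒ u v w)) l fun j c => Yᵒ (Y v j u) c w := by
  obtain ⟨N, hN⟩ := hV.truncation v u
  refine ⟨(-N).toNat, fun w => ?_⟩
  obtain ⟨k, hk⟩ := hV.assoc w v
  have hreflect : HasOPE (fun n m => (-1 : ℂ) ^ m • Y (Yᵒ v n w) m u) (-N).toNat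
      fun j c => (-1 : ℂ) ^ c • Y w c (Y v j u) :=
    (hk.hasOPE_swap hV hV.isModule.isTranslationCovariant u).reflect fun p q hq =>
      (congrArg (Y w p) (hN q (by lia))).trans (map_zero _)
  have hLaurent : ∀ n, IsLaurent fun m => (-1 : ℂ) ^ m • Y (Yᵒ v n w) m u := fun n => by
    obtain ⟨N, hN⟩ := hV.truncation (Yᵒ v n w) u
    exact ⟨N, fun m hm => smul_eq_zero_of_right _ (hN m hm)⟩
  -- apply `e ^ (x 𝒟)`, where `x` is the second variable
  let T : ℕ → Module.End ℂ V := fun s => (LinearMap.proj (s : ℤ) ∘ₗ Y).flip one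
  have hT : ∀ (a b : V) (n : ℤ),
      ∑ᶠ s : ℕ, T s ((-1 : ℂ) ^ (n - s) • Y b (n - s) a) = Yᵒ a n b := fun a b n => by
    simp only [map_smul, oppositeY_apply hV]
    rfl
  convert hreflect.operatorSeriesMul hLaurent T using 1
  · ext n m
    exact (hT u (Yᵒ v n w) m).symm
  · ext j c
    exact (hT (Y v j u) w c).symm

theorem isTranslationCovariant_oppositeY : IsTranslationCovariant Y one Yᵒ := fun a l c w => by
  obtain ⟨k, hk⟩ := exists_hasOPE_swap_oppositeY hV one a
  have hOPE := hk w
  rw [prodCoeff_one_left (oppositeY_one hV)] at hOPE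
  exact hOPE.eq_of_const_right (truncation_oppositeY hV a w) l c

theorem IsNonlocalVertexAlgebra.opposite : IsNonlocalVertexAlgebra Yᵒ one where
  truncation := truncation_oppositeY hV
  vacuum := oppositeY_one hV
  creation u n hn := (oppositeY_apply_one hV u n).trans (hV.creation u n hn)
  creation_limit u := (oppositeY_apply_one hV u 0).trans (hV.creation_limit u)
  assoc u v := by
    obtain ⟨l, hl⟩ := exists_hasOPE_swap_oppositeY hV u v
    refine ⟨l, fun w => ?_⟩
    simpa only [apply_oppositeY hV (isTranslationCovariant_oppositeY hV)] using (hl w).swap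

theorem oppositeY_oppositeY : oppositeY Yᵒ one hV.opposite.truncation = Y := by
  ext u j v
  obtain ⟨k, hk⟩ := hV.assoc u v
  have hOPE := (hk.hasOPE_swap hV hV.isModule.isTranslationCovariant one).swap
  have h := congrFun₂ (hOPE.eq (hk one)) j 0
  rw [hV.creation_limit] at h
  rw [oppositeY_apply hV.opposite, ← h]
  simp only [oppositeY_apply_one hV, zero_add, zchoose_natCast_natCast, Nat.choose_self,
    Nat.cast_one, mul_one]

end Opposite

/-! ### The `S`-Jacobi identity for constant `S` -/

section Jacobi

variable {V : Type*} [AddCommGroup V] [Module ℂ V] {W : Type*} [AddCommGroup W] [Module ℂ W]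
  {Y : V →ₗ[ℂ] (ℤ → Module.End ℂ V)} {YW : V →ₗ[ℂ] (ℤ → Module.End ℂ W)} {one u v : V} {r : ℕ}
  {u' v' : Fin r → V} {k : ℕ}

theorem jacobiLeft₁_eq (u v w : V) (a b c : ℤ) :
    jacobiLeft₁ Y u v w a b c = mulPow (-a - 1) (prodCoeff Y u v w) b c := by
  refine finsum_congr fun i => ?_
  rw [prodCoeff, sub_add]

theorem jacobiLeft₂_one (u v w : V) (a b c : ℤ) : jacobiLeft₂ Y 1 u v w a b c =
    (-1 : ℂ) ^ (-a - 1) • mulPow (-a - 1) (prodCoeff Y v u w) c b := by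
  rw [jacobiLeft₂, mulPow, ← finsum_comp_of_injective (e := fun i : ℕ => ((0 : ℤ), i))
    fun i j h => (Prod.ext_iff.1 h).2]
  · simp only [prodCoeff, HahnSeries.coeff_one, if_true, one_mul, add_zero, sub_add]
  · rintro ⟨m, i⟩ h
    by_cases hm : m = 0
    · exact ⟨i, by rw [hm]⟩
    · exact (h (by simp only [HahnSeries.coeff_one, if_neg hm, zero_mul, zero_smul])).elim

theorem jacobiRight_eq (u v w : V) (a b c : ℤ) : jacobiRight Y u v w a b c =
    ∑ᶠ i : ℕ, zchoose (-b - 1) i • Y (Y u (a - i) v) (b + c + 1 + i) w := by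
  refine finsum_congr fun i => ?_
  rw [subPowCoeff_eq, zchoose_neg (-b - 1), zpow_natCast]
  congr 3 <;> ring_nf

theorem sJacobi_one_iff (hT : ∀ u v : V, IsLaurent fun n => Y u n v) :
    SJacobi Y u v u' v' (fun _ => 1) ↔ ∀ (w : V) (a b c : ℤ),
      mulPow (-a - 1) (prodCoeff Y u v w) b c - (-1 : ℂ) ^ (-a - 1) •
        mulPow (-a - 1) (∑ i, prodCoeff Y (v' i) (u' i) w) c b =
      ∑ᶠ i : ℕ, zchoose (-b - 1) i • Y (Y u (a - i) v) (b + c + 1 + i) w := by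
  refine forall₄_congr fun w a b c => ?_
  rw [mulPow_sum _ _ fun i => isTruncatedRight_prodCoeff (hT (u' i) w) (v' i)]
  simp only [jacobiLeft₁_eq, jacobiLeft₂_one, jacobiRight_eq, Finset.sum_apply, Finset.smul_sum]

/-- `S`-locality with exponent `k`, for `S(v ⊗ u) = ∑ᵢ v' i ⊗ u' i`:
`(x₁ - x₂) ^ k Y_W(u, x₁) Y_W(v, x₂) = (x₁ - x₂) ^ k ∑ᵢ Y_W(v' i, x₂) Y_W(u' i, x₁)`. -/
def IsSLocalAt (YW : V →ₗ[ℂ] (ℤ → Module.End ℂ W)) (u v : V) (u' v' : Fin r → V) (k : ℕ) : Prop :=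
  ∀ w, mulPow k (prodCoeff YW u v w) = mulPow k (swap (∑ i, prodCoeff YW (v' i) (u' i) w))

/-- `S`-locality of all pairs of vertex operators, for some constant `S`. -/
def IsSLocal (YW : V →ₗ[ℂ] (ℤ → Module.End ℂ W)) : Prop :=
  ∀ u v, ∃ (r : ℕ) (u' v' : Fin r → V) (k : ℕ), IsSLocalAt YW u v u' v' k

theorem isTruncatedRight_sum_prodCoeff {w : W} (hT : ∀ v, IsLaurent fun n => YW v n w)
    (u' v' : Fin r → V) : IsTruncatedRight (∑ i, prodCoeff YW (v' i) (u' i) w) :=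
  .sum _ fun i => isTruncatedRight_prodCoeff (hT (u' i)) (v' i)

theorem IsSLocalAt.mono (h : IsSLocalAt YW u v u' v' k) (hT : ∀ v w, IsLaurent fun n => YW v n w)
    {l : ℕ} (hl : k ≤ l) : IsSLocalAt YW u v u' v' l := fun w => by
  obtain ⟨m, rfl⟩ := Nat.exists_eq_add_of_le' hl
  rw [← mulPow_mulPow_swap (isTruncatedRight_sum_prodCoeff (hT · w) u' v'), ← h w,
    mulPow_mulPow (isTruncatedRight_prodCoeff (hT v w) u), Nat.cast_add]

theorem IsSLocalAt.sJacobi (hS : IsSLocalAt Y u v u' v' k)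
    (hT : ∀ u v : V, IsLaurent fun n => Y u n v) (hA : IsAssocAt Y Y u v k) :
    SJacobi Y u v u' v' (fun _ => 1) := by
  refine (sJacobi_one_iff hT).2 fun w a b c => ?_
  rw [(hA w).mulPow_sub_mulPow (isTruncatedRight_prodCoeff (hT v w) u)
    (isTruncatedRight_sum_prodCoeff (hT · w) u' v') (hS w)]
  simp only [neg_sub, sub_neg_eq_add, add_sub_cancel_left]

theorem SJacobi.exists_isSLocalAt (h : SJacobi Y u v u' v' (fun _ => 1))
    (hT : ∀ u v : V, IsLaurent fun n => Y u n v) : ∃ k, IsSLocalAt Y u v u' v' k := by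
  obtain ⟨N, hN⟩ := hT u v
  set k := (-N).toNat
  refine ⟨k, fun w => ?_⟩
  ext b c
  have hJ := (sJacobi_one_iff hT).1 h w (-k - 1) b c
  have hzero : ∀ i : ℕ, Y u (-k - 1 - i) v = 0 := fun i => hN _ (by lia)
  simp only [hzero, map_zero, Pi.zero_apply, LinearMap.zero_apply, smul_zero, finsum_zero] at hJ
  rw [show -(-(k : ℤ) - 1) - 1 = k by ring, sub_eq_zero] at hJ
  rw [hJ, mulPow_swap k (∑ i, _), zpow_natCast]
  rfl

theorem SJacobi.exists_isAssocAt (h : SJacobi Y u v u' v' (fun _ => 1))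
    (hT : ∀ u v : V, IsLaurent fun n => Y u n v) : ∃ k, IsAssocAt Y Y u v k := by
  obtain ⟨k, hk⟩ := h.exists_isSLocalAt hT
  refine ⟨k, fun w => ?_⟩
  convert hasOPE_of_local (isTruncatedRight_prodCoeff (hT v w) u)
    (isTruncatedRight_sum_prodCoeff (hT · w) u' v') (hk w) using 3 with j c
  rw [(sJacobi_one_iff hT).1 h, finsum_eq_single _ 0]
  · simp
  · intro i hi
    rw [neg_neg, sub_self, zchoose_zero_left, if_neg (Nat.cast_ne_zero.2 hi), zero_smul]

theorem HasConstantS.isNonlocalVertexAlgebra (hS : HasConstantS Y)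
    (hV : IsWeakQuantumVertexAlgebra Y one) : IsNonlocalVertexAlgebra Y one where
  __ := hV
  assoc u v :=
    let ⟨_, hS⟩ := hS
    let ⟨_, _, _, _, h⟩ := hS u v
    h.exists_isAssocAt hV.truncation

theorem HasConstantS.isSLocal (hS : HasConstantS Y) (hT : ∀ u v : V, IsLaurent fun n => Y u n v) :
    IsSLocal Y := fun u v =>
  let ⟨_, hS⟩ := hS
  let ⟨r, u', v', _, h⟩ := hS u v
  ⟨r, u', v', h.exists_isSLocalAt hT⟩

end Jacobi

/-! ### Skew symmetry -/

section SkewSymmetry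

variable {V : Type*} [AddCommGroup V] [Module ℂ V] {W : Type*} [AddCommGroup W] [Module ℂ W]
  {Y : V →ₗ[ℂ] (ℤ → Module.End ℂ V)} {YW : V →ₗ[ℂ] (ℤ → Module.End ℂ W)} {one u v : V} {r : ℕ}
  {u' v' : Fin r → V}

theorem IsModule.eventually_hasOPE_sum_prodCoeff (hW : IsModule Y one YW) (u' v' : Fin r → V) :
    ∀ᶠ k in Filter.atTop, ∀ w, HasOPE (∑ i, prodCoeff YW (v' i) (u' i) w) k
      fun j c => YW (∑ i, Y (v' i) j (u' i)) c w := by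
  filter_upwards [Filter.eventually_all.2 fun i => hW.eventually_isAssocAt (v' i) (u' i)]
    with k hk w
  convert HasOPE.sum Finset.univ
    (fun i => isTruncatedRight_prodCoeff (hW.truncation (u' i) w) (v' i)) fun i => hk i w using 1
  ext j c
  simp only [map_sum, Finset.sum_apply, LinearMap.sum_apply]

variable (hV : IsNonlocalVertexAlgebra Y one)

local notation "Yᵒ" => oppositeY Y one (IsNonlocalVertexAlgebra.truncation hV)

theorem oppositeY_eq_sum (h : ∃ k, IsSLocalAt Y u v u' v' k) (j : ℤ) :
    Yᵒ v j u = ∑ i, Y (v' i) j (u' i) := by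
  obtain ⟨l, hl⟩ := h
  obtain ⟨k, hk, hA, hA'⟩ := ((Filter.eventually_ge_atTop l).and <|
    (hV.isModule.eventually_isAssocAt u v).and <|
      hV.isModule.eventually_hasOPE_sum_prodCoeff u' v').exists
  have hmul := mulPow_swap_eq_of_eq_mulPow_swap (hl.mono hV.truncation hk one)
  have hOPE := (hA.hasOPE_swap hV hV.isModule.isTranslationCovariant one).congr hmul
  have heq := congrFun₂ (hOPE.eq (hA' one)) j 0
  rwa [hV.creation_limit, hV.creation_limit] at heq

theorem eq_sum_oppositeY (h : ∃ k, IsSLocalAt Y v u v' u' k) (j : ℤ) :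
    Y v j u = ∑ i, Yᵒ (v' i) j (u' i) := by
  have hsupp : ∀ i, (support fun l : ℕ =>
      (-1 : ℂ) ^ (j - l) • Y (Y (u' i) (j - l) (v' i)) l one).Finite := fun i =>
    ((hV.truncation (u' i) (v' i)).finite_support_sub j).subset fun l hl h => hl <| by
      simp only [h, map_zero, Pi.zero_apply, LinearMap.zero_apply, smul_zero]
  conv_lhs => rw [← oppositeY_oppositeY hV]
  simp only [oppositeY_apply hV.opposite, oppositeY_apply_one hV, oppositeY_eq_sum hV h,
    oppositeY_apply hV, map_sum, Finset.sum_apply, LinearMap.sum_apply, Finset.smul_sum]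
  exact finsum_sum_comm _ _ fun i _ => hsupp i

theorem IsModule.exists_isSLocalAt (hW : IsModule Y one YW)
    (h : ∀ j, Yᵒ v j u = ∑ i, Y (v' i) j (u' i)) : ∃ k, IsSLocalAt YW u v u' v' k := by
  obtain ⟨k, hA, hA'⟩ :=
    ((hW.eventually_isAssocAt u v).and (hW.eventually_hasOPE_sum_prodCoeff u' v')).exists
  refine ⟨k, fun w => ?_⟩
  have hOPE := hA.hasOPE_swap hV hW.isTranslationCovariant w
  simp only [h] at hOPE
  exact (mulPow_swap_eq_of_eq_mulPow_swap ((hA' w).mulPow_eq hOPE)).symm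

end SkewSymmetry

section SLocal

variable {V : Type*} [AddCommGroup V] [Module ℂ V] {W : Type*} [AddCommGroup W] [Module ℂ W]
  {Y : V →ₗ[ℂ] (ℤ → Module.End ℂ V)} {YW : V →ₗ[ℂ] (ℤ → Module.End ℂ W)} {one : V}

theorem IsSLocal.of_isModule (hS : IsSLocal Y) (hV : IsNonlocalVertexAlgebra Y one)
    (hW : IsModule Y one YW) : IsSLocal YW := fun u v =>
  let ⟨r, u', v', h⟩ := hS u v
  ⟨r, u', v', hW.exists_isSLocalAt hV (oppositeY_eq_sum hV h)⟩

theorem IsSLocal.opposite (hS : IsSLocal Y) (hV : IsNonlocalVertexAlgebra Y one) :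
    IsSLocal (oppositeY Y one hV.truncation) := fun u v =>
  let ⟨r, v', u', h⟩ := hS v u
  ⟨r, u', v', hV.opposite.isModule.exists_isSLocalAt hV.opposite fun j => by
    rw [oppositeY_oppositeY hV, eq_sum_oppositeY hV h]⟩

theorem IsNonlocalVertexAlgebra.isWeakQuantumVertexAlgebra (hV : IsNonlocalVertexAlgebra Y one)
    (hS : IsSLocal Y) : IsWeakQuantumVertexAlgebra Y one where
  __ := hV
  jacobi u v := by
    obtain ⟨r, u', v', l, hl⟩ := hS u v
    obtain ⟨k, hk, hA⟩ :=
      ((Filter.eventually_ge_atTop l).and (hV.isModule.eventually_isAssocAt u v)).exists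
    exact ⟨r, u', v', fun _ => 1, (hl.mono hV.truncation hk).sJacobi hV.truncation hA⟩

end SLocal

/-! ### The dual module -/

section Dual

variable {V : Type*} [AddCommGroup V] [Module ℂ V] {W : Type*} [AddCommGroup W] [Module ℂ W]
  {Y : V →ₗ[ℂ] (ℤ → Module.End ℂ V)} {YW : V →ₗ[ℂ] (ℤ → Module.End ℂ W)} {one u v : V} {k : ℕ}

theorem dualY_apply (v : V) (n : ℤ) (α : Module.Dual ℂ W) (w : W) :
    dualY YW v n α w = α (YW v (-n) w) := rfl

/-- Substituting `x₁⁻¹` and `x₂⁻¹` turns `(x₁ - x₂) ^ k` into `(x₁ * x₂) ^ (-k) * (x₂ - x₁) ^ k`. -/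
theorem mulPow_apply_of_transpose {P : ℤ → ℤ → Module.Dual ℂ W} {Q : ℤ → ℤ → W}
    {α : Module.Dual ℂ W} {w : W} (h : ∀ p q, P p q w = α (Q (-q) (-p))) (k : ℕ) (m n : ℤ) :
    mulPow k P m n w = α (mulPow k Q (k - n) (k - m)) := by
  simp only [mulPow_natCast, LinearMap.sum_apply, LinearMap.smul_apply, map_sum, map_smul, h]
  refine Finset.sum_congr rfl fun i _ => ?_
  congr 3 <;> ring

theorem mulPow_prodCoeff_dualY_apply (k : ℕ) (u v : V) (α : Module.Dual ℂ W) (m n : ℤ) (w : W) :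
    mulPow k (prodCoeff (dualY YW) u v α) m n w =
      α (mulPow k (prodCoeff YW v u w) (k - n) (k - m)) :=
  mulPow_apply_of_transpose (fun _ _ => rfl) k m n

theorem IsSLocalAt.dual {r : ℕ} {u' v' : Fin r → V} (h : IsSLocalAt YW u v u' v' k) :
    IsSLocalAt (dualY YW) v u v' u' k := fun α => by
  ext m n w
  rw [mulPow_prodCoeff_dualY_apply, h w, ← mulPow_apply_of_transpose]
  intro p q
  simp only [swap, Finset.sum_apply, LinearMap.sum_apply, map_sum]
  rfl

theorem IsSLocal.dual (h : IsSLocal YW) : IsSLocal (dualY YW) := fun u v =>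
  let ⟨r, v', u', k, h⟩ := h v u
  ⟨r, u', v', k, h.dual⟩

theorem IsSLocalAt.isLaurent₂_mulPow {r : ℕ} {u' v' : Fin r → V} (h : IsSLocalAt YW u v u' v' k)
    {w : W} (hw : ∀ v, IsLaurent fun n => YW v n w) :
    IsLaurent₂ (mulPow k (prodCoeff YW u v w)) :=
  (hasOPE_of_local (isTruncatedRight_prodCoeff (hw v) u) (isTruncatedRight_sum_prodCoeff hw u' v')
    (h w)).1

theorem IsLaurent₂.isLaurent_mulPow {U : Type*} [AddCommGroup U] [Module ℂ U] {A : ℤ → ℤ → U}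
    (hA : IsLaurent₂ A) (n q : ℤ) : IsLaurent fun p => mulPow n A p q := by
  obtain ⟨N, hN⟩ := hA
  refine ⟨N + n - (q - N), fun p hp => finsum_eq_zero_of_forall_eq_zero fun i => ?_⟩
  rw [hN _ _ (by lia), smul_zero]

theorem IsSLocal.isLaurent_apply (hS : IsSLocal YW) {w : W}
    (hw : ∀ v, IsLaurent fun n => YW v n w) (v : V) (n : ℤ) (u : V) :
    IsLaurent fun m => YW u m (YW v n w) := by
  obtain ⟨r, u', v', k, h⟩ := hS u v
  have hP : prodCoeff YW u v w = mulPow (-k) (mulPow k (prodCoeff YW u v w)) := by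
    rw [mulPow_mulPow (isTruncatedRight_prodCoeff (hw v) u), neg_add_cancel, mulPow_zero]
  have hL := (h.isLaurent₂_mulPow hw).isLaurent_mulPow (-k) n
  rwa [← hP] at hL

theorem dualY_mem_dualSpace (hS : IsSLocal YW) (v : V) (n : ℤ) (α : Module.Dual ℂ W)
    (hα : α ∈ dualSpace YW) : dualY YW v n α ∈ dualSpace YW :=
  hS.dual.isLaurent_apply hα v n

variable (h : ∀ (v : V) (n : ℤ), ∀ α ∈ dualSpace YW, dualY YW v n α ∈ dualSpace YW)

local notation "YD" => restrictY (dualY YW) (dualSpace YW) h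

theorem coe_mulPowCoeff_restrictY_dualY (k : ℕ) (u v : V) (α : dualSpace YW) (m n : ℤ) :
    (mulPowCoeff (W := dualSpace YW) YD k u v α m n : Module.Dual ℂ W) =
      mulPow k (prodCoeff (dualY YW) u v α.1) m n := by
  rw [← mulPowCoeff_eq, mulPowCoeff, mulPowCoeff, Submodule.coe_sum]
  rfl

theorem isLaurent₂_mulPowCoeff_restrictY {r : ℕ} {u' v' : Fin r → V}
    (hS : IsSLocalAt YW v u v' u' k) (α : dualSpace YW) : IsLaurent₂ (mulPowCoeff YD k u v α) := by
  obtain ⟨N, hN⟩ := hS.dual.isLaurent₂_mulPow α.2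
  exact ⟨N, fun m n hmn => Subtype.ext <|
    (coe_mulPowCoeff_restrictY_dualY h k u v α m n).trans (hN m n hmn)⟩

theorem lineSum_mulPow_prodCoeff_dualY (hV : IsNonlocalVertexAlgebra Y one)
    (hD : IsTranslationCovariant Y one YW) (hA : IsAssocAt Y YW v u k) (α : Module.Dual ℂ W)
    (j c : ℤ) (w : W) :
    lineSum (fun m n => mulPow k (prodCoeff (dualY YW) u v α) m n w) (c - j)
        (fun m => zchoose (-m) j) =
      ∑ᶠ i : ℕ, ((-1) ^ k * zchoose (-k) i) •
        dualY YW (oppositeY Y one hV.truncation u (j - k - i) v) (c - 2 * k - i) α w := by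
  obtain ⟨hL, hB⟩ := hA.hasOPE_swap hV hD w
  set A := mulPow k (swap (prodCoeff YW v u w))
  have hαA : (fun m n => mulPow k (prodCoeff (dualY YW) u v α) m n w) =
      fun m n => ((-1 : ℂ) ^ k • fun p q => α (A p q)) (k - m) (k - n) := by
    ext m n
    rw [mulPow_prodCoeff_dualY_apply, Pi.smul_apply, Pi.smul_apply, ← map_smul]
    exact congrArg α (congrFun₂ (swap_mulPow k (prodCoeff YW v u w)) (k - m) (k - n))
  have hweight : (fun m : ℤ => zchoose (-(k - m)) j) = fun m => zchoose (-k + m) j := by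
    ext m
    rw [neg_sub, sub_eq_neg_add]
  rw [hαA, lineSum_reflect, lineSum_smul, hweight, lineSum_zchoose_add (hL.map α), smul_finsum]
  refine finsum_congr fun i => ?_
  rw [taylorCoeff, ← hL.map_lineSum α, ← taylorCoeff, hB, smul_smul, dualY_apply,
    sub_right_comm j (k : ℤ), show 2 * k - (c - j) - (j - i) = -(c - 2 * k - i) by ring]

theorem substCoeff_phiStar_restrictY_dualY (hV : IsNonlocalVertexAlgebra Y one)
    (hD : IsTranslationCovariant Y one YW) (hA : IsAssocAt Y YW v u k) {α : dualSpace YW}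
    (hL : IsLaurent₂ (mulPowCoeff YD k u v α)) (j c : ℤ) :
    substCoeff phiStar (mulPowCoeff YD k u v α) j c =
      iterateCoeff (oppositeY Y one hV.truncation) YD ((phiStar - varX) ^ k) u v α j c := by
  ext w
  let T : dualSpace YW →ₗ[ℂ] ℂ := LinearMap.applyₗ w ∘ₗ (dualSpace YW).subtype
  change T _ = T _
  have hT : ∀ m n, T (mulPowCoeff YD k u v α m n) = mulPow k (prodCoeff (dualY YW) u v α) m n w :=
    fun m n => congrArg (LinearMap.applyₗ w) (coe_mulPowCoeff_restrictY_dualY h k u v α m n)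
  rw [iterateCoeff_phiStar, map_finsum T, ← coordPow_neg_one_one, substCoeff_coordPow,
    hL.map_lineSum T]
  · simp only [neg_one_mul, ← sub_eq_add_neg, hT]
    exact lineSum_mulPow_prodCoeff_dualY hV hD hA α.1 j c w
  · refine ((truncation_oppositeY hV u v).finite_support_sub (j - k)).subset fun i hi hz => hi ?_
    simp only [hz, map_zero, Pi.zero_apply, LinearMap.zero_apply, smul_zero]

theorem restrictY_dualY_one (hone : YW one = Pi.single 0 1) : YD one = Pi.single 0 1 := by
  ext n α w
  change α.1 (YW one (-n) w) = _
  rw [hone]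
  rcases eq_or_ne n 0 with rfl | hn
  · rw [neg_zero, Pi.single_eq_same, Pi.single_eq_same, Module.End.one_apply, Module.End.one_apply]
  · rw [Pi.single_eq_of_ne (neg_ne_zero.2 hn), Pi.single_eq_of_ne hn, LinearMap.zero_apply,
      map_zero]
    rfl

theorem isPhiCoordinatedModule_restrictY_dualY (hV : IsNonlocalVertexAlgebra Y one)
    (hW : IsModule Y one YW) (hS : IsSLocal YW) :
    IsPhiCoordinatedModule phiStar (oppositeY Y one hV.truncation) one YD where
  truncation v α :=
    let ⟨N, hN⟩ := α.2 v
    ⟨N, fun n hn => Subtype.ext (hN n hn)⟩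
  vacuum := restrictY_dualY_one h hW.vacuum
  assoc u v := by
    obtain ⟨r, u', v', l, hl⟩ := hS v u
    obtain ⟨k, hk, hA⟩ := ((Filter.eventually_ge_atTop l).and (hW.eventually_isAssocAt v u)).exists
    have hL := isLaurent₂_mulPowCoeff_restrictY h (hl.mono hW.truncation hk)
    exact ⟨k, hL, fun α =>
      substCoeff_phiStar_restrictY_dualY h hV hW.isTranslationCovariant hA (hL α)⟩

end Dual

end WQVA

end

theorem theorem3p6 {V : Type*} [AddCommGroup V] [Module ℂ V] {W : Type*} [AddCommGroup W]
    [Module ℂ W] (Y : V →ₗ[ℂ] (ℤ → Module.End ℂ V)) (one : V)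
    (hV : WQVA.IsWeakQuantumVertexAlgebra Y one) (hS : WQVA.HasConstantS Y)
    (YW : V →ₗ[ℂ] (ℤ → Module.End ℂ W)) (hW : WQVA.IsModule Y one YW) :
    (∀ (v : V), ∀ α ∈ WQVA.dualSpace YW,
      (∀ n : ℤ, WQVA.dualY YW v n α ∈ WQVA.dualSpace YW) ∧
        WQVA.IsLaurent fun n => WQVA.dualY YW v n α) ∧
    WQVA.IsWeakQuantumVertexAlgebra (WQVA.oppositeY Y one hV.truncation) one ∧
    ∃ h : ∀ (v : V) (n : ℤ), ∀ α ∈ WQVA.dualSpace YW, WQVA.dualY YW v n α ∈ WQVA.dualSpace YW,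
      WQVA.IsPhiCoordinatedModule WQVA.phiStar (WQVA.oppositeY Y one hV.truncation) one
        (WQVA.restrictY (WQVA.dualY YW) (WQVA.dualSpace YW) h) := by
  have hN := hS.isNonlocalVertexAlgebra hV
  have hloc := hS.isSLocal hV.truncation
  have hlocW := hloc.of_isModule hN hW
  have hstable := WQVA.dualY_mem_dualSpace hlocW
  have hopp := hN.opposite.isWeakQuantumVertexAlgebra (hloc.opposite hN)
  exact ⟨fun v α hα => ⟨fun n => hstable v n α hα, hα v⟩, hopp, hstable,
    WQVA.isPhiCoordinatedModule_restrictY_dualY hstable hN hW hlocW⟩
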